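/- **Setting.** Let $n\ge 1$, $m\ge 2$, $1<p_0<\infty$, $\frac1{p_0}+\frac1{p_0'}=1$, $0<\alpha p_0'<mn$. Cubes $Q\subset\mathbb R^n$ have sides parallel to the axes, $|Q|$ is the Lebesgue measure, $Q(x,l)$ is the cube with centre $x$ and side length $l$, $g_Q=\frac1{|Q|}\int_Q g$. Functions are real- or complex-valued. Let $K(x,y_1,\dots,y_m)$ be a function on $(\mathbb R^n)^{m+1}$ that is locally integrable away from the diagonal $x=y_1=\cdots=y_m$ and for which there are constants $A>0$ and $C_k>0$ $(k=1,2,\dots)$ such that, off the diagonal, $$|K(x,\vec y)|\le \frac{A}{\big(\sum_{j=1}^m|x-y_j|\big)^{mn-\alpha}},$$ and, for all $k\ge 1$ and all $x\ne x'$, $$\Big(\int_{Q(x,2^{k+2}\sqrt{mn}|x-x'|)^m\setminus Q(x,2^{k+1}\sqrt{mn}|x-x'|)^m}|K(x,\vec y)-K(x',\vec y)|^{p_0}\,d\vec y\Big)^{1/p_0}\le A\,C_k\,2^{k(\alpha-\frac{mn}{p_0'})}|x-x'|^{\alpha-\frac{mn}{p_0'}}.$$ Let $1\le s_1,\dots,s_m\le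 p_0'$ and $\frac1s=\frac1{s_1}+\cdots+\frac1{s_m}$. Let $T_\alpha$ be an $m$-linear operator which is bounded from $L^{s_1}\times\cdots\times L^{s_m}$ to $L^{\frac{sn}{n-s\alpha},\infty}$ and which satisfies, for all Schwartz functions $f_1,\dots,f_m$ and almost every $x\notin\bigcap_{j}\operatorname{supp}f_j$, $$T_\alpha(\vec f)(x)=\int_{(\mathbb R^n)^m}K(x,\vec y)\prod_{j=1}^m f_j(y_j)\,d\vec y .$$ For locally integrable $b$ let $\|b\|_{\rm BMO}=\sup_Q\frac1{|Q|}\int_Q|b-b_Q|$, and let ${\rm BMO}$ be the set of such $b$ with $\|b\|_{\rm BMO}<\infty$. For $\vec b=(b_1,\dots,b_m)\in{\rm BMO}^m$ put $\|\vec b\|_{{\rm BMO}^m}=\max_i\|b_i\|_{\rm BMO}$ and $$T_{\vec b,\alpha}(\vec f)=\sum_{i=1}^m\big(b_i\,T_\alpha(f_1,\dots,f_m)-T_\alpha(f_1,\dots,b_if_i,\dots,f_m)\big).$$ For $r>0$ let $M_r(g)(x)=\big(\sup_{Q\ni x}\frac1{|Q|}\int_Q|g|^r\big)^{1/r}$,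 $M_r^\sharp(g)(x)=\big(\sup_{Q\ni x}\frac1{|Q|}\int_Q\big||g|^r-(|g|^r)_Q\big|\big)^{1/r}$, and for $r>1$ let $\mathcal M_{\alpha,r}(\vec f)(x)=\sup_{Q\ni x}|Q|^{\alpha/n}\prod_{j=1}^m\big(\frac1{|Q|}\int_Q|f_j|^r\big)^{1/r}$. **Theorem 2.2.** In this setting suppose that $\sum_{k=1}^\infty k\,C_k<\infty$, $0<\delta<\min\{1,\frac{sn}{n-s\alpha}\}$, $p_0'<t<\infty$ and $\delta<\varepsilon<\infty$. Then there is a constant $C>0$ such that for all $\vec b\in{\rm BMO}^m$, all $m$-tuples $\vec f=(f_1,\dots,f_m)$ of bounded measurable functions with compact support, and all $x\in\mathbb R^n$, $$M_\delta^\sharp\big(T_{\vec b,\alpha}(\vec f)\big)(x)\le C\,\|\vec b\|_{{\rm BMO}^m}\Big(\mathcal M_{\alpha,t}(\vec f)(x)+M_\varepsilon\big(T_\alpha(\vec f)\big)(x)\Big).$$ -/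

import Mathlib

open MeasureTheory Set
open scoped ENNReal SchwartzMap

namespace FracMultilinear

noncomputable section

/-- Euclidean space `ℝⁿ` with the Euclidean norm and Lebesgue measure. -/
abbrev Rn (n : ℕ) := EuclideanSpace ℝ (Fin n)

/-- The (closed) cube with centre `c`, side length `l`, and sides parallel to the axes. -/
def cube {n : ℕ} (c : Rn n) (l : ℝ) : Set (Rn n) :=
  {y | ∀ i, |y i - c i| ≤ l / 2}

/-! ### Maximal operators

Suprema run over all cubes of positive side length that contain `x`; all values are in
`[0, ∞]`. -/

/-- `M_δ f (x) = (sup_{Q ∋ x} |Q|⁻¹ ∫_Q |f|^δ)^{1/δ}`. -/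
def powMaximal {n : ℕ} {𝕜 : Type*} [RCLike 𝕜] (δ : ℝ) (f : Rn n → 𝕜) (x : Rn n) : ℝ≥0∞ :=
  (⨆ (c : Rn n) (l : ℝ) (_ : 0 < l) (_ : x ∈ cube c l),
    ⨍⁻ y in cube c l, ‖f y‖ₑ ^ δ ∂volume) ^ (1 / δ)

/-- The sharp maximal function `M^♯ g (x) = sup_{Q ∋ x} |Q|⁻¹ ∫_Q |g - g_Q|`.
When the measurable function `g` is not integrable on some cube containing `x`,
the value is `∞`. -/
def sharpMaximal {n : ℕ} (g : Rn n → ℝ) (x : Rn n) : ℝ≥0∞ :=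
  ⨆ (c : Rn n) (l : ℝ) (_ : 0 < l) (_ : x ∈ cube c l),
    ⨍⁻ y in cube c l, ‖g y - ⨍ z in cube c l, g z‖ₑ ∂volume

/-- `M_δ^♯ f (x) = (M^♯ (|f|^δ) (x))^{1/δ}`. -/
def powSharpMaximal {n : ℕ} {𝕜 : Type*} [RCLike 𝕜] (δ : ℝ) (f : Rn n → 𝕜) (x : Rn n) :
    ℝ≥0∞ :=
  (sharpMaximal (fun y => ‖f y‖ ^ δ) x) ^ (1 / δ)

/-- The multilinear fractional maximal operator
`sup_{Q ∋ x} |Q|^{α/n} ∏_j (|Q|⁻¹ ∫_Q |f_j|^r)^{1/r}`. -/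
def multiFracMaximal {n m : ℕ} {𝕜 : Type*} [RCLike 𝕜] (α r : ℝ) (f : Fin m → Rn n → 𝕜)
    (x : Rn n) : ℝ≥0∞ :=
  ⨆ (c : Rn n) (l : ℝ) (_ : 0 < l) (_ : x ∈ cube c l),
    (volume (cube c l)) ^ (α / n) * ∏ j, (⨍⁻ y in cube c l, ‖f j y‖ₑ ^ r ∂volume) ^ (1 / r)

/-! ### BMO -/

/-- `‖b‖_BMO = sup_Q |Q|⁻¹ ∫_Q |b - b_Q|`. -/
def bmoNorm {n : ℕ} {𝕜 : Type*} [RCLike 𝕜] (b : Rn n → 𝕜) : ℝ≥0∞ :=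
  ⨆ (c : Rn n) (l : ℝ) (_ : 0 < l),
    ⨍⁻ y in cube c l, ‖b y - ⨍ z in cube c l, b z‖ₑ ∂volume

/-- Membership in `BMO(ℝⁿ)`. -/
def MemBMO {n : ℕ} {𝕜 : Type*} [RCLike 𝕜] (b : Rn n → 𝕜) : Prop :=
  LocallyIntegrable b volume ∧ bmoNorm b < ∞

/-- The norm of a tuple in `BMO^m`: the largest of the norms of the entries. -/
def bmoNormVec {n m : ℕ} {𝕜 : Type*} [RCLike 𝕜] (b : Fin m → Rn n → 𝕜) : ℝ≥0∞ :=
  ⨆ j, bmoNorm (b j)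

/-! ### Kernels and operators -/

/-- The weak Lebesgue quasi-norm `‖g‖_{L^{q,∞}} = sup_{a > 0} a |{|g| > a}|^{1/q}`. -/
def weakNorm {n : ℕ} {𝕜 : Type*} [RCLike 𝕜] (q : ℝ) (g : Rn n → 𝕜) : ℝ≥0∞ :=
  ⨆ (a : ℝ) (_ : 0 < a), ENNReal.ofReal a * (volume {x | a < ‖g x‖}) ^ (1 / q)

/-- `K(x, y₁, …, y_m)` is a locally integrable function away from the diagonal
`x = y₁ = ⋯ = y_m` which satisfies the size condition of order `α` there. -/
structure IsFracKernel {n m : ℕ} {𝕜 : Type*} [RCLike 𝕜] (α : ℝ)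
    (K : Rn n → (Fin m → Rn n) → 𝕜) : Prop where
  locallyIntegrable :
    LocallyIntegrableOn (Function.uncurry K)
      {p : Rn n × (Fin m → Rn n) | ¬ ∀ j, p.2 j = p.1} volume
  size : ∃ A : ℝ, 0 < A ∧ ∀ (x : Rn n) (y : Fin m → Rn n), (¬ ∀ j, y j = x) →
    ‖K x y‖ ≤ A / (∑ j, ‖x - y j‖) ^ ((m : ℝ) * n - α)

/-- The product `Q(x, 2^i √(mn) r)^m ⊆ (ℝⁿ)^m` of `m` copies of the cube centred at `x`
with side length `2^i √(mn) r`. -/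
def cubePow {n : ℕ} (m : ℕ) (i : ℕ) (x : Rn n) (r : ℝ) : Set (Fin m → Rn n) :=
  {y | ∀ j, y j ∈ cube x (2 ^ i * √((m : ℝ) * n) * r)}

/-- The generalized smoothness condition: the `L^{p₀}` norm of `K(x, ·) - K(x', ·)` over the
`k`-th annulus around `x`, `k ≥ 1`, is at most a constant times
`C_k 2^{k(α - mn/p₀')} |x - x'|^{α - mn/p₀'}`. -/
def GeneralizedSmooth {n m : ℕ} {𝕜 : Type*} [RCLike 𝕜] (α p₀ p₀' : ℝ) (Ck : ℕ → ℝ)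
    (K : Rn n → (Fin m → Rn n) → 𝕜) : Prop :=
  ∃ A : ℝ, 0 < A ∧ ∀ k : ℕ, 1 ≤ k → ∀ x x' : Rn n, x ≠ x' →
    (∫⁻ y in cubePow m (k + 2) x ‖x - x'‖ \ cubePow m (k + 1) x ‖x - x'‖,
        ‖K x y - K x' y‖ₑ ^ p₀) ^ (1 / p₀) ≤
      ENNReal.ofReal (A * Ck k * (2 : ℝ) ^ ((k : ℝ) * (α - (m : ℝ) * n / p₀')) *
        ‖x - x'‖ ^ (α - (m : ℝ) * n / p₀'))

/-- `m`-linear maps from `L^{s₁}(ℝⁿ) × ⋯ × L^{s_m}(ℝⁿ)` to the space of (almost everywhere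
classes of) measurable functions on `ℝⁿ`. -/
abbrev LpMultilinear (n m : ℕ) (𝕜 : Type*) [RCLike 𝕜] (s : Fin m → ℝ) :=
  MultilinearMap 𝕜
    (fun j : Fin m => Lp 𝕜 (ENNReal.ofReal (s j)) (volume : Measure (Rn n)))
    (Rn n →ₘ[(volume : Measure (Rn n))] 𝕜)

/-- `T` is represented by the kernel `K` off the common support: for Schwartz functions `f_j`,
`T(f₁, …, f_m)(x) = ∫ K(x, y₁, …, y_m) ∏_j f_j(y_j) dy` at (almost) every
`x ∉ ⋂_j supp f_j`. -/
def HasKernel {n m : ℕ} {𝕜 : Type*} [RCLike 𝕜] {s : Fin m → ℝ}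
    (T : LpMultilinear n m 𝕜 s) (K : Rn n → (Fin m → Rn n) → 𝕜) : Prop :=
  ∀ f : Fin m → 𝓢(Rn n, 𝕜), ∀ᵐ x ∂(volume : Measure (Rn n)), x ∉ ⋂ j, tsupport (f j) →
    T (fun j => (f j).toLp (ENNReal.ofReal (s j)) volume) x =
      ∫ y : Fin m → Rn n, K x y * ∏ j, f j (y j)

/-- `T` maps `L^{s₁} × ⋯ × L^{s_m}` boundedly to `L^{q,∞}`. -/
def WeakBounded {n m : ℕ} {𝕜 : Type*} [RCLike 𝕜] {s : Fin m → ℝ}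
    (T : LpMultilinear n m 𝕜 s) (q : ℝ) : Prop :=
  ∃ B : ℝ, 0 < B ∧ ∀ f : (j : Fin m) → Lp 𝕜 (ENNReal.ofReal (s j)) (volume : Measure (Rn n)),
    weakNorm q (T f) ≤
      ENNReal.ofReal B * ∏ j, eLpNorm (f j) (ENNReal.ofReal (s j)) volume

/-- `T` is an `m`-linear fractional integral operator of order `α` with generalized kernel `K`:
the size and generalized smoothness conditions hold for `K`, the operator `T` has kernel `K`,
and `T` is bounded from `L^{s₁} × ⋯ × L^{s_m}` to `L^{sn/(n - sα),∞}`, where `σ` stands for `s`. -/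
structure IsGeneralizedFracOperator {n m : ℕ} {𝕜 : Type*} [RCLike 𝕜] {s : Fin m → ℝ}
    (α p₀ p₀' σ : ℝ) (Ck : ℕ → ℝ) (K : Rn n → (Fin m → Rn n) → 𝕜)
    (T : LpMultilinear n m 𝕜 s) : Prop where
  kernel : IsFracKernel α K
  smooth : GeneralizedSmooth α p₀ p₀' Ck K
  hasKernel : HasKernel T K
  weakBounded : WeakBounded T (σ * n / (n - σ * α))

open Classical in
/-- The value `T(f₁, …, f_m)`, as a function on `ℝⁿ`, for functions `f_j ∈ L^{s_j}`
(and `0` for tuples outside the domain). -/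
def applyFun {n m : ℕ} {𝕜 : Type*} [RCLike 𝕜] {s : Fin m → ℝ}
    (T : LpMultilinear n m 𝕜 s) (f : Fin m → Rn n → 𝕜) : Rn n → 𝕜 :=
  if h : ∀ j, MemLp (f j) (ENNReal.ofReal (s j)) (volume : Measure (Rn n)) then
    T (fun j => (h j).toLp (f j))
  else 0

/-- The multilinear commutator
`T_b(f)(x) = ∑_i (b_i(x) T(f₁, …, f_m)(x) - T(f₁, …, b_i f_i, …, f_m)(x))`. -/
def multiCommutator {n m : ℕ} {𝕜 : Type*} [RCLike 𝕜] {s : Fin m → ℝ}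
    (T : LpMultilinear n m 𝕜 s) (b f : Fin m → Rn n → 𝕜) (x : Rn n) : 𝕜 :=
  ∑ i, (b i x * applyFun T f x -
    applyFun T (Function.update f i (fun y => b i y * f i y)) x)

end

end FracMultilinear

open FracMultilinear

open Filter Topology

/-! ### Averages and level sets -/

/-! Fix a cube `Q` of side `l` containing `x`, put `L = 13mn`, and let `κ_i` be the mean of `b_i`
over `LQ`. Since `δ < 1`, `||u|^δ - |v|^δ| ≤ |u - v|^δ`, so it is enough to find on each `Q` one
constant from which the commutator has controlled `L^δ` deviation (`powSharpMaximal_le`). By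
multilinearity each `b_i` may be replaced by `b_i - κ_i`; the commutator is then the sum over `i` of
`(b_i - κ_i) T(f) - T(g_i)`, where `g_i` is `f` with its `i`-th entry multiplied by `b_i - κ_i`.
This leaves three kinds of terms.

The product `(b_i - κ_i) T(f)` is handled by Hölder with `1/δ = 1/r + 1/ε` and John–Nirenberg, which
produces `M_ε(T f)` (`oscillation_mul_le`).

When all entries of `g_i` are cut off to `LQ`, Kolmogorov's inequality and the weak-type bound
apply. Hölder trades `s_i < t` for a `BMO` factor, and `1/q = 1/s - α/n` leaves exactly the power
`|LQ|^{α/n}` (`local_part_le`).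

The rest of `T(g_i)` is given on `Q` by the integral `I_i(z)` of the kernel over the complement of
`(LQ)^m` (`applyFun_sub_applyFun_indicator`). The constant `I_i(w)` is subtracted from it, for a
point `w` with `|z - w|` comparable to `l`. The smoothness condition and Hölder with exponents `p₀,
p₀'` bound the `k`-th annulus by `C_k` times an average over `2^k LQ`. On that cube the oscillation
of `b_i` about `κ_i` costs a factor of order `k`, because the means drift linearly in `k`; hence the
condition `∑ k C_k < ∞` (`far_part_le`).

Two preliminaries support this. John–Nirenberg is proved for balls of any finite-dimensional normed
space by a Vitali covering argument; cubes are the balls of the sup norm. The kernel representation,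
given for Schwartz functions only, is extended by density to compactly supported entries
(`applyFun_eq_integral`). -/

theorem ENNReal.le_mul_of_forall_ofReal {X C w : ℝ≥0∞} (hC : C ≠ ∞) (hw : w ≠ ∞)
    (h : ∀ τ : ℝ, 0 < τ → w ≤ ENNReal.ofReal τ → X ≤ C * ENNReal.ofReal τ) : X ≤ C * w := by
  have hlim : Tendsto (fun k : ℕ => C * ENNReal.ofReal (w.toReal + 1 / ((k : ℝ) + 1))) atTop
      (𝓝 (C * w)) := by
    refine ENNReal.Tendsto.const_mul ?_ (Or.inr hC)
    have h1 : Tendsto (fun k : ℕ => w.toReal + 1 / ((k : ℝ) + 1)) atTop (𝓝 (w.toReal + 0)) :=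
      tendsto_const_nhds.add tendsto_one_div_add_atTop_nhds_zero_nat
    have h2 := ENNReal.tendsto_ofReal h1
    rwa [add_zero, ENNReal.ofReal_toReal hw] at h2
  refine ge_of_tendsto' hlim fun k => ?_
  have hk : (0 : ℝ) < 1 / ((k : ℝ) + 1) := by positivity
  refine h _ (by positivity) ?_
  rw [← ENNReal.ofReal_toReal hw]
  exact ENNReal.ofReal_le_ofReal (by simpa using hk.le)

/-- A discrete layer-cake bound: each point is charged to the first level that dominates `h` there.
The levels are left free because John–Nirenberg uses an arithmetic progression and Kolmogorov's
inequality a geometric one. -/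
theorem lintegral_rpow_le_of_levels {X : Type*} [MeasurableSpace X] {μ : Measure X}
    {h : X → ℝ≥0∞} (hh : AEMeasurable h μ) {a : ℕ → ℝ≥0∞} (ha : ∀ x, ∃ k, h x ≤ a k)
    {p : ℝ} (hp : 0 ≤ p) :
    ∫⁻ x, h x ^ p ∂μ ≤ a 0 ^ p * μ univ + ∑' k, a (k + 1) ^ p * μ {x | a k < h x} := by
  classical
  have hpt : ∀ x, h x ^ p ≤ a 0 ^ p +
      ∑' k, ({x | a k < h x}).indicator (fun _ => a (k + 1) ^ p) x := by
    intro x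
    obtain hk | ⟨j, hj⟩ : Nat.find (ha x) = 0 ∨ ∃ j, Nat.find (ha x) = j + 1 := by
      cases Nat.find (ha x) <;> simp
    · have := Nat.find_spec (ha x)
      rw [hk] at this
      exact (ENNReal.rpow_le_rpow this hp).trans le_self_add
    · have h1 := Nat.find_spec (ha x)
      rw [hj] at h1
      have h2 : a j < h x := not_le.1 (Nat.find_min (ha x) (by omega))
      refine le_trans ?_ le_add_self
      refine le_trans ?_ (ENNReal.le_tsum j)
      rw [indicator_of_mem (by exact h2)]
      exact ENNReal.rpow_le_rpow h1 hp
  have hm : ∀ k, NullMeasurableSet {x | a k < h x} μ := fun k =>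
    nullMeasurableSet_lt aemeasurable_const hh
  calc ∫⁻ x, h x ^ p ∂μ ≤ ∫⁻ x, (a 0 ^ p +
      ∑' k, ({x | a k < h x}).indicator (fun _ => a (k + 1) ^ p) x) ∂μ := lintegral_mono hpt
    _ = _ := by
      rw [lintegral_add_left measurable_const, lintegral_const,
        lintegral_tsum (fun k => aemeasurable_const.indicator₀ (hm k))]
      congr 1
      exact tsum_congr fun k => lintegral_indicator_const₀ (hm k) _

theorem enorm_average_sub_mul_le {X F : Type*} [MeasurableSpace X] [NormedAddCommGroup F]
    [NormedSpace ℝ F] [CompleteSpace F] {μ : Measure X} {S : Set X} {b : X → F}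
    (hb : IntegrableOn b S μ)
    (h0 : μ S ≠ 0) (hS : μ S ≠ ∞) (κ : F) :
    ‖(⨍ y in S, b y ∂μ) - κ‖ₑ * μ S ≤ ∫⁻ y in S, ‖b y - κ‖ₑ ∂μ := by
  have hc : IntegrableOn (fun _ : X => κ) S μ := integrableOn_const hS
  have hr : 0 < μ.real S := ENNReal.toReal_pos h0 hS
  have h1 : (μ.real S) • ((⨍ y in S, b y ∂μ) - κ) = ∫ y in S, (b y - κ) ∂μ := by
    rw [integral_sub hb hc, setAverage_eq, smul_sub, smul_smul, mul_inv_cancel₀ hr.ne', one_smul]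
    simp
  have h2 := enorm_integral_le_lintegral_enorm (μ := μ.restrict S) fun y => b y - κ
  rw [← h1, enorm_smul] at h2
  rw [mul_comm]
  convert h2 using 2
  rw [Real.enorm_eq_ofReal hr.le, Measure.real, ENNReal.ofReal_toReal hS]

/-- Replacing the average by any other constant costs at most a factor two. -/
theorem lintegral_enorm_sub_average_le {X F : Type*} [MeasurableSpace X] [NormedAddCommGroup F]
    [NormedSpace ℝ F] [CompleteSpace F] {μ : Measure X} {S : Set X} {h : X → F}
    (hh : AEStronglyMeasurable h (μ.restrict S)) (hS : μ S ≠ ∞) (κ : F) :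
    ∫⁻ y in S, ‖h y - ⨍ z in S, h z ∂μ‖ₑ ∂μ ≤ 2 * ∫⁻ y in S, ‖h y - κ‖ₑ ∂μ := by
  by_cases h0 : μ S = 0
  · simp [Measure.restrict_eq_zero.2 h0]
  by_cases hi : IntegrableOn h S μ
  · calc ∫⁻ y in S, ‖h y - ⨍ z in S, h z ∂μ‖ₑ ∂μ
        ≤ ∫⁻ y in S, (‖h y - κ‖ₑ + ‖(⨍ z in S, h z ∂μ) - κ‖ₑ) ∂μ := by
          refine lintegral_mono fun y => ?_
          rw [← sub_sub_sub_cancel_right (h y) _ κ]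
          exact enorm_sub_le
      _ = ∫⁻ y in S, ‖h y - κ‖ₑ ∂μ + ‖(⨍ z in S, h z ∂μ) - κ‖ₑ * μ S := by
          rw [lintegral_add_right _ measurable_const, setLIntegral_const]
      _ ≤ _ := by
          rw [two_mul]
          gcongr
          exact enorm_average_sub_mul_le hi h0 hS κ
  -- Without integrability the right-hand side is infinite: on a set of finite measure,
  -- integrability of `h - κ` would give that of `h`.
  · have : ∫⁻ y in S, ‖h y - κ‖ₑ ∂μ = ∞ := by
      by_contra hne
      have h1 : IntegrableOn (fun y => h y - κ) S μ :=
        ⟨hh.sub aestronglyMeasurable_const, lt_top_iff_ne_top.2 hne⟩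
      have h2 := h1.add (integrableOn_const (C := κ) hS)
      exact hi (h2.congr (Eventually.of_forall fun y => sub_add_cancel (h y) κ))
    rw [this]
    simp

/-! ### The John–Nirenberg inequality -/

section JohnNirenberg

variable {E F : Type*} [NormedAddCommGroup E] [NormedSpace ℝ E] [FiniteDimensional ℝ E]
  [MeasurableSpace E] [BorelSpace E] [NormedAddCommGroup F] [NormedSpace ℝ F] [CompleteSpace F]

open Metric Module

theorem addHaar_closedBall_mul_eq (μ : Measure E) [μ.IsAddHaarMeasure] (x y : E) {r τ : ℝ}
    (hr : 0 ≤ r) (hτ : 0 ≤ τ) :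
    μ (closedBall x (τ * r)) = ENNReal.ofReal (τ ^ finrank ℝ E) * μ (closedBall y r) := by
  rw [Measure.addHaar_closedBall μ x (by positivity), Measure.addHaar_closedBall μ y hr, mul_pow,
    ENNReal.ofReal_mul (by positivity), mul_assoc]

theorem norm_average_sub_le_of_closedBall_subset (μ : Measure E) [μ.IsAddHaarMeasure] {b : E → F}
    (hb : LocallyIntegrable b μ) {x y : E} {r τ : ℝ} (hr : 0 < r) (hτ : 0 ≤ τ)
    (hsub : closedBall y r ⊆ closedBall x (τ * r)) {κ : F} {θ : ℝ} (hθ : 0 ≤ θ)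
    (h : ∫⁻ z in closedBall x (τ * r), ‖b z - κ‖ₑ ∂μ ≤
      ENNReal.ofReal θ * μ (closedBall x (τ * r))) :
    ‖(⨍ z in closedBall y r, b z ∂μ) - κ‖ ≤ τ ^ finrank ℝ E * θ := by
  have h0 : μ (closedBall y r) ≠ 0 := (measure_closedBall_pos μ y hr).ne'
  have ht : μ (closedBall y r) ≠ ∞ := measure_closedBall_lt_top.ne
  have h1 := (enorm_average_sub_mul_le (hb.integrableOn_isCompact (isCompact_closedBall y r))
    h0 ht κ).trans ((lintegral_mono_set hsub).trans h)
  rw [addHaar_closedBall_mul_eq μ x y hr.le hτ, ← mul_assoc] at h1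
  have h2 := (ENNReal.mul_le_mul_iff_left h0 ht).1 h1
  rw [← ENNReal.ofReal_mul hθ, ← ofReal_norm,
    ENNReal.ofReal_le_ofReal_iff (by positivity)] at h2
  linarith

/-- One step of the John–Nirenberg iteration: raising the level by a fixed multiple of the mean
oscillation halves the measure of the superlevel sets. -/
theorem measure_oscillation_halve (μ : Measure E) [μ.IsAddHaarMeasure] {b : E → F}
    (hb : LocallyIntegrable b μ) {β : ℝ} (hβ0 : 0 < β)
    (hβ : ∀ (c : E) (r : ℝ), 0 < r →
      ∫⁻ y in closedBall c r, ‖b y - ⨍ z in closedBall c r, b z ∂μ‖ₑ ∂μ ≤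
        ENNReal.ofReal β * μ (closedBall c r))
    {lam : ℝ} (hlam : 0 ≤ lam) {q : ℝ≥0∞}
    (hq : ∀ (c : E) (r : ℝ), 0 < r →
      μ {y ∈ closedBall c r | lam < ‖b y - ⨍ z in closedBall c r, b z ∂μ‖} ≤
        q * μ (closedBall c r)) (c : E) {R : ℝ} (hR : 0 < R) :
    μ {y ∈ closedBall c R | lam + 2 * 10 ^ finrank ℝ E * (1 + 2 ^ finrank ℝ E) * β <
        ‖b y - ⨍ z in closedBall c R, b z ∂μ‖} ≤ q / 2 * μ (closedBall c R) := by
  set D := finrank ℝ E with hD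
  -- The increment is chosen so that `5^D * 2^D * (1 + 2^D) * β / a = 1/2`. Here `5^D` is the cost
  -- of the Vitali enlargement, and `2^D * (1 + 2^D) * β` bounds the integral of `|b - M|` over the
  -- doubled ball relative to the measure of the original one.
  set a : ℝ := 2 * 10 ^ D * (1 + 2 ^ D) * β with ha
  have ha0 : 0 < a := by positivity
  set M := ⨍ z in closedBall c R, b z ∂μ with hM
  set N := ⨍ z in closedBall c (2 * R), b z ∂μ with hN
  have hMN : ‖M - N‖ ≤ 2 ^ D * β :=
    norm_average_sub_le_of_closedBall_subset μ hb hR zero_le_two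
      (closedBall_subset_closedBall (by linarith)) hβ0.le (hβ c (2 * R) (by linarith))
  have hsubR : ∀ y ∈ closedBall c R, closedBall y R ⊆ closedBall c (2 * R) := by
    intro y hy
    refine closedBall_subset_closedBall' ?_
    rw [mem_closedBall] at hy
    linarith
  have hyN : ∀ y ∈ closedBall c R, ‖(⨍ z in closedBall y R, b z ∂μ) - M‖ ≤ a := by
    intro y hy
    have h1 : ‖(⨍ z in closedBall y R, b z ∂μ) - N‖ ≤ 2 ^ D * β :=
      norm_average_sub_le_of_closedBall_subset μ hb hR zero_le_two (hsubR y hy) hβ0.le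
        (hβ c (2 * R) (by linarith))
    have h2 : ‖(⨍ z in closedBall y R, b z ∂μ) - M‖ ≤ 2 ^ D * β + 2 ^ D * β := by
      rw [← sub_sub_sub_cancel_right _ M N]
      exact (norm_sub_le _ _).trans (add_le_add h1 hMN)
    have h3 : (1 : ℝ) ≤ 10 ^ D := one_le_pow₀ (by norm_num)
    have h4 : (0 : ℝ) < 2 ^ D := by positivity
    have h5 : (0:ℝ) < 2 * (1 + 2 ^ D) * β := by positivity
    calc _ ≤ _ := h2
      _ ≤ 1 * (2 * (1 + 2 ^ D) * β) := by nlinarith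
      _ ≤ 10 ^ D * (2 * (1 + 2 ^ D) * β) := by gcongr
      _ = a := by rw [ha]; ring
  -- By Lebesgue differentiation only a null set is lost when convergence of the averages is
  -- required.
  set G : Set E := {y ∈ closedBall c R | lam + a < ‖b y - M‖ ∧
    Tendsto (fun k : ℕ => ⨍ z in closedBall y ((1 / 5) ^ k * R), b z ∂μ) atTop (𝓝 (b y))}
    with hG
  have hGae : μ {y ∈ closedBall c R | lam + a < ‖b y - M‖} ≤ μ G := by
    refine measure_mono_ae ?_
    filter_upwards [IsUnifLocDoublingMeasure.ae_tendsto_average μ hb 1] with y hy hmem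
    refine ⟨hmem.1, hmem.2, hy (fun _ => y) (fun k : ℕ => (1 / 5 : ℝ) ^ k * R) ?_ ?_⟩
    · refine tendsto_nhdsWithin_iff.2 ⟨?_, Eventually.of_forall fun k => ?_⟩
      · simpa using (tendsto_pow_atTop_nhds_zero_of_lt_one (r := (1 / 5 : ℝ)) (by norm_num)
          (by norm_num)).mul_const R
      · exact mem_Ioi.2 (by positivity)
    · exact Eventually.of_forall fun k => mem_closedBall_self (by positivity)
  refine hGae.trans ?_
  -- Stopping time: take the first radius `5^{-k} R` at which the mean deviates from `M` by more
  -- than `a`. It is not the initial one, by `hyN`, so at the preceding radius, five times larger,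
  -- the mean is still within `a` of `M`.
  have hstep : ∀ y ∈ G, ∃ k : ℕ,
      a < ‖(⨍ z in closedBall y ((1 / 5) ^ (k + 1) * R), b z ∂μ) - M‖ ∧
      ‖(⨍ z in closedBall y ((1 / 5) ^ k * R), b z ∂μ) - M‖ ≤ a := by
    classical
    intro y hy
    have hex : ∃ k : ℕ, a < ‖(⨍ z in closedBall y ((1 / 5) ^ k * R), b z ∂μ) - M‖ := by
      have h1 : Tendsto (fun k : ℕ => ‖(⨍ z in closedBall y ((1 / 5) ^ k * R), b z ∂μ) - M‖)
        atTop (𝓝 ‖b y - M‖) := (hy.2.2.sub_const M).norm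
      exact (h1.eventually_const_lt (by linarith [hy.2.1])).exists
    obtain hk | ⟨j, hj⟩ : Nat.find hex = 0 ∨ ∃ j, Nat.find hex = j + 1 := by
      cases Nat.find hex <;> simp
    · have := Nat.find_spec hex
      rw [hk, pow_zero, one_mul] at this
      exact absurd (hyN y hy.1) (not_le.2 this)
    · refine ⟨j, ?_, not_lt.1 (Nat.find_min hex (by omega))⟩
      have := Nat.find_spec hex
      rwa [hj] at this
  choose! k hk1 hk2 using hstep
  set r : E → ℝ := fun y => (1 / 5) ^ (k y + 1) * R with hr
  have hrpos : ∀ y, 0 < r y := fun y => by simp only [hr]; positivity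
  have hr5 : ∀ y, 5 * r y = (1 / 5) ^ (k y) * R := fun y => by
    simp only [hr, pow_succ]; ring
  have hrR : ∀ y, r y ≤ R := fun y => by
    simp only [hr]
    exact mul_le_of_le_one_left hR.le (pow_le_one₀ (by norm_num) (by norm_num))
  obtain ⟨u, huG, hdisj, hcov⟩ := Vitali.exists_disjoint_subfamily_covering_enlargement_closedBall
    G id r R (fun y _ => hrR y) 5 (by norm_num)
  simp only [id] at hdisj hcov
  have hcount : u.Countable := hdisj.countable_of_nonempty_interior fun y _ =>
    ⟨y, ball_subset_interior_closedBall (mem_ball_self (hrpos y))⟩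
  have := hcount.to_subtype
  -- The mean over an enlarged ball is within `a` of `M`, so exceeding `lam + a` relative to `M`
  -- means exceeding `lam` relative to that ball's own mean, where `hq` applies.
  have hcover : G ⊆ ⋃ y : u, {w ∈ closedBall (y : E) (5 * r y) |
      lam < ‖b w - ⨍ z in closedBall (y : E) (5 * r y), b z ∂μ‖} := by
    intro w hw
    obtain ⟨y, hyu, hy⟩ := hcov w hw
    refine mem_iUnion.2 ⟨⟨y, hyu⟩, hy (mem_closedBall_self (hrpos w).le), ?_⟩
    have h1 := hk2 y (huG hyu)
    rw [← hr5] at h1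
    have h2 := hw.2.1
    have h3 : ‖b w - M‖ ≤ ‖b w - ⨍ z in closedBall y (5 * r y), b z ∂μ‖ +
        ‖(⨍ z in closedBall y (5 * r y), b z ∂μ) - M‖ := norm_sub_le_norm_sub_add_norm_sub _ _ _
    simp only
    linarith
  -- On each selected ball `a` is less than the mean of `|b - M|`; the balls are disjoint and lie in
  -- the doubled ball.
  have hsum : ENNReal.ofReal a * ∑' y : u, μ (closedBall (y : E) (r y)) ≤
      ENNReal.ofReal (2 ^ D * (1 + 2 ^ D) * β) * μ (closedBall c R) := by
    rw [← ENNReal.tsum_mul_left]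
    calc ∑' y : u, ENNReal.ofReal a * μ (closedBall (y : E) (r y))
        ≤ ∑' y : u, ∫⁻ z in closedBall (y : E) (r y), ‖b z - M‖ₑ ∂μ := by
          refine ENNReal.tsum_le_tsum fun y => ?_
          refine le_trans ?_ (enorm_average_sub_mul_le
            (hb.integrableOn_isCompact (isCompact_closedBall _ _))
            (measure_closedBall_pos μ _ (hrpos y)).ne' measure_closedBall_lt_top.ne M)
          gcongr
          rw [← ofReal_norm]
          exact ENNReal.ofReal_le_ofReal (hk1 y (huG y.2)).le
      _ = ∫⁻ z in ⋃ y : u, closedBall (y : E) (r y), ‖b z - M‖ₑ ∂μ :=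
          (lintegral_iUnion (s := fun y : u => closedBall (y : E) (r y))
            (fun y => measurableSet_closedBall)
            (fun y y' hne => hdisj y.2 y'.2 fun h => hne (Subtype.ext h)) _).symm
      _ ≤ ∫⁻ z in closedBall c (2 * R), ‖b z - M‖ₑ ∂μ := by
          refine lintegral_mono_set (iUnion_subset fun y => ?_)
          exact (closedBall_subset_closedBall (hrR y)).trans (hsubR y (huG y.2).1)
      _ ≤ ∫⁻ z in closedBall c (2 * R), (‖b z - N‖ₑ + ‖M - N‖ₑ) ∂μ := by
          refine lintegral_mono fun z => ?_
          rw [← sub_sub_sub_cancel_right (b z) M N]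
          exact enorm_sub_le
      _ = ∫⁻ z in closedBall c (2 * R), ‖b z - N‖ₑ ∂μ + ‖M - N‖ₑ * μ (closedBall c (2 * R)) := by
          rw [lintegral_add_right _ measurable_const, setLIntegral_const]
      _ ≤ ENNReal.ofReal β * μ (closedBall c (2 * R)) +
            ENNReal.ofReal (2 ^ D * β) * μ (closedBall c (2 * R)) := by
          gcongr
          · exact hβ c (2 * R) (by linarith)
          · rw [← ofReal_norm]
            exact ENNReal.ofReal_le_ofReal hMN
      _ = _ := by
          rw [addHaar_closedBall_mul_eq μ c c hR.le zero_le_two, ← add_mul,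
            ← ENNReal.ofReal_add hβ0.le (by positivity), ← mul_assoc,
            ← ENNReal.ofReal_mul (by positivity), ← hD]
          congr 2
          ring
  have hsum2 : ∑' y : u, μ (closedBall (y : E) (5 * r y)) ≤ 2⁻¹ * μ (closedBall c R) := by
    have h1 : ∀ y : u, μ (closedBall (y : E) (5 * r y)) =
        ENNReal.ofReal (5 ^ D) * μ (closedBall (y : E) (r y)) := fun y =>
      addHaar_closedBall_mul_eq μ _ _ (hrpos y).le (by norm_num)
    simp_rw [h1]
    rw [ENNReal.tsum_mul_left]
    have hpos : (0 : ℝ) < 2 * 2 ^ D * (1 + 2 ^ D) * β := by positivity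
    rw [← ENNReal.mul_le_mul_iff_right (ENNReal.ofReal_pos.2 hpos).ne' ENNReal.ofReal_ne_top,
      ← mul_assoc, ← ENNReal.ofReal_mul hpos.le, ← mul_assoc]
    have e1 : 2 * 2 ^ D * (1 + 2 ^ D) * β * 5 ^ D = a := by
      rw [ha, show (10 : ℝ) = 2 * 5 by norm_num, mul_pow]; ring
    have e2 : ENNReal.ofReal (2 * 2 ^ D * (1 + 2 ^ D) * β) * 2⁻¹ =
        ENNReal.ofReal (2 ^ D * (1 + 2 ^ D) * β) := by
      rw [show (2⁻¹ : ℝ≥0∞) = ENNReal.ofReal 2⁻¹ by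
        rw [ENNReal.ofReal_inv_of_pos two_pos]; simp, ← ENNReal.ofReal_mul hpos.le]
      congr 1
      ring
    rw [e1, e2]
    exact hsum
  calc μ G ≤ ∑' y : u, μ {w ∈ closedBall (y : E) (5 * r y) |
      lam < ‖b w - ⨍ z in closedBall (y : E) (5 * r y), b z ∂μ‖} :=
        (measure_mono hcover).trans (measure_iUnion_le _)
    _ ≤ ∑' y : u, q * μ (closedBall (y : E) (5 * r y)) :=
        ENNReal.tsum_le_tsum fun y => hq _ _ (mul_pos (by norm_num) (hrpos y))
    _ ≤ q * (2⁻¹ * μ (closedBall c R)) := by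
        rw [ENNReal.tsum_mul_left]
        gcongr
    _ = _ := by rw [div_eq_mul_inv, mul_assoc]

theorem tsum_rpow_mul_geometric_ne_top (p : ℝ) :
    ∑' k : ℕ, ENNReal.ofReal ((k : ℝ) + 1) ^ p * (2⁻¹ : ℝ≥0∞) ^ k ≠ ∞ := by
  set N := ⌈p⌉₊
  have h1 : Summable fun k : ℕ => ((k + 1 : ℕ) : ℝ) ^ N * (1 / 2 : ℝ) ^ (k + 1) :=
    (summable_nat_add_iff 1).2
      (summable_pow_mul_geometric_of_norm_lt_one N (r := (1 / 2 : ℝ)) (by norm_num))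
  refine ne_top_of_le_ne_top (h1.mul_left 2).tsum_ofReal_ne_top (ENNReal.tsum_le_tsum fun k => ?_)
  have h2 : (2⁻¹ : ℝ≥0∞) ^ k = ENNReal.ofReal ((1 / 2) ^ k) := by
    rw [ENNReal.ofReal_pow (by norm_num), one_div, ENNReal.ofReal_inv_of_pos two_pos]
    simp
  have hk : (1 : ℝ) ≤ (k : ℝ) + 1 := by linarith [(Nat.cast_nonneg k : (0 : ℝ) ≤ k)]
  rw [h2, ENNReal.ofReal_rpow_of_pos (by linarith), ← ENNReal.ofReal_mul (by positivity)]
  refine ENNReal.ofReal_le_ofReal ?_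
  have h3 : ((k : ℝ) + 1) ^ p ≤ ((k : ℝ) + 1) ^ N := by
    rw [← Real.rpow_natCast]
    exact Real.rpow_le_rpow_of_exponent_le hk (Nat.le_ceil p)
  have h4 : (2 : ℝ) * (((k + 1 : ℕ) : ℝ) ^ N * (1 / 2 : ℝ) ^ (k + 1)) =
      ((k : ℝ) + 1) ^ N * (1 / 2) ^ k := by
    push_cast
    ring
  rw [h4]
  gcongr

theorem measure_oscillation_le_geometric (μ : Measure E) [μ.IsAddHaarMeasure] {b : E → F}
    (hb : LocallyIntegrable b μ) {β : ℝ} (hβ0 : 0 < β)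
    (hβ : ∀ (c : E) (r : ℝ), 0 < r →
      ∫⁻ y in closedBall c r, ‖b y - ⨍ z in closedBall c r, b z ∂μ‖ₑ ∂μ ≤
        ENNReal.ofReal β * μ (closedBall c r)) (k : ℕ) :
    ∀ (c : E) (r : ℝ), 0 < r →
      μ {y ∈ closedBall c r | k * (2 * 10 ^ finrank ℝ E * (1 + 2 ^ finrank ℝ E) * β) <
        ‖b y - ⨍ z in closedBall c r, b z ∂μ‖} ≤ 2⁻¹ ^ k * μ (closedBall c r) := by
  induction k with
  | zero =>
    intro c r _
    rw [pow_zero, one_mul]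
    exact measure_mono fun y hy => hy.1
  | succ k ih =>
    intro c r hr
    have h := measure_oscillation_halve μ hb hβ0 hβ (by positivity) ih c hr
    rw [pow_succ, ← div_eq_mul_inv]
    convert h using 6
    push_cast
    ring

/-- The John–Nirenberg inequality: functions of bounded mean oscillation have bounded `L^p`
oscillation for every `p`. -/
theorem john_nirenberg (μ : Measure E) [μ.IsAddHaarMeasure] (F : Type*) [NormedAddCommGroup F]
    [NormedSpace ℝ F] [CompleteSpace F] {p : ℝ} (hp : 0 < p) :
    ∃ C : ℝ≥0∞, C ≠ ∞ ∧ ∀ b : E → F, LocallyIntegrable b μ → ∀ β : ℝ, 0 < β →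
      (∀ (c : E) (r : ℝ), 0 < r →
        ∫⁻ y in closedBall c r, ‖b y - ⨍ z in closedBall c r, b z ∂μ‖ₑ ∂μ ≤
          ENNReal.ofReal β * μ (closedBall c r)) →
      ∀ (c : E) (r : ℝ), 0 < r →
        ∫⁻ y in closedBall c r, ‖b y - ⨍ z in closedBall c r, b z ∂μ‖ₑ ^ p ∂μ ≤
          C * ENNReal.ofReal β ^ p * μ (closedBall c r) := by
  set A : ℝ := 2 * 10 ^ finrank ℝ E * (1 + 2 ^ finrank ℝ E) with hA
  have hA0 : 0 < A := by positivity
  refine ⟨ENNReal.ofReal A ^ p * ∑' k : ℕ, ENNReal.ofReal ((k : ℝ) + 1) ^ p * 2⁻¹ ^ k,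
    ENNReal.mul_ne_top (ENNReal.rpow_ne_top_of_nonneg hp.le ENNReal.ofReal_ne_top)
      (tsum_rpow_mul_geometric_ne_top p), ?_⟩
  intro b hb β hβ0 hβ c r hr
  have hmeas : AEMeasurable (fun y => ‖b y - ⨍ z in closedBall c r, b z ∂μ‖ₑ)
      (μ.restrict (closedBall c r)) :=
    (hb.aestronglyMeasurable.restrict.sub aestronglyMeasurable_const).enorm
  have hlev : ∀ x, ∃ k : ℕ, ‖b x - ⨍ z in closedBall c r, b z ∂μ‖ₑ ≤
      ENNReal.ofReal (k * (A * β)) := by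
    intro x
    obtain ⟨k, hk⟩ := exists_nat_ge (‖b x - ⨍ z in closedBall c r, b z ∂μ‖ / (A * β))
    refine ⟨k, ?_⟩
    rw [← ofReal_norm]
    exact ENNReal.ofReal_le_ofReal ((div_le_iff₀ (by positivity)).1 hk)
  refine (lintegral_rpow_le_of_levels hmeas hlev hp.le).trans ?_
  rw [Nat.cast_zero, zero_mul, ENNReal.ofReal_zero, ENNReal.zero_rpow_of_pos hp, zero_mul, zero_add,
    mul_assoc (_ * _) (ENNReal.ofReal β ^ p), mul_assoc (ENNReal.ofReal A ^ p), ← ENNReal.tsum_mul_right, ← ENNReal.tsum_mul_left]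
  refine ENNReal.tsum_le_tsum fun k => ?_
  have h1 : (μ.restrict (closedBall c r))
      {x | ENNReal.ofReal (k * (A * β)) < ‖b x - ⨍ z in closedBall c r, b z ∂μ‖ₑ} ≤
      2⁻¹ ^ k * μ (closedBall c r) := by
    rw [Measure.restrict_apply' measurableSet_closedBall]
    refine (measure_mono ?_).trans (measure_oscillation_le_geometric μ hb hβ0 hβ k c r hr)
    rintro y ⟨hy1, hy2⟩
    refine ⟨hy2, ?_⟩
    rw [mem_ofPred_eq, ← ofReal_norm] at hy1
    exact (ENNReal.ofReal_lt_ofReal_iff_of_nonneg (by positivity)).1 hy1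
  calc _ ≤ ENNReal.ofReal ((k + 1 : ℕ) * (A * β)) ^ p * (2⁻¹ ^ k * μ (closedBall c r)) := by gcongr
    _ = _ := by
      rw [Nat.cast_add, Nat.cast_one, ENNReal.ofReal_mul (by positivity), ENNReal.ofReal_mul hA0.le,
        ENNReal.mul_rpow_of_nonneg _ _ hp.le, ENNReal.mul_rpow_of_nonneg _ _ hp.le]
      ring

end JohnNirenberg

namespace FracMultilinear

/-! ### Cubes and normalized Lebesgue measure on them -/

section Cubes

variable {n : ℕ}

theorem toLp_preimage_cube (c : Rn n) {l : ℝ} (hl : 0 < l) :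
    (WithLp.toLp 2 : (Fin n → ℝ) → Rn n) ⁻¹' cube c l = Metric.closedBall (WithLp.ofLp c) (l / 2) := by
  ext y
  simp [cube, Metric.mem_closedBall, dist_pi_le_iff (by positivity : 0 ≤ l / 2), Real.dist_eq]

theorem isClosed_cube (c : Rn n) (l : ℝ) : IsClosed (cube c l) := by
  simp only [cube, ofPred_forall]
  exact isClosed_iInter fun i => isClosed_le (by fun_prop) continuous_const

theorem measurableSet_cube (c : Rn n) (l : ℝ) : MeasurableSet (cube c l) :=
  (isClosed_cube c l).measurableSet

theorem measurePreserving_toLp :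
    MeasurePreserving (WithLp.toLp 2 : (Fin n → ℝ) → Rn n) volume volume :=
  PiLp.volume_preserving_toLp (Fin n)

theorem measurableEmbedding_toLp :
    MeasurableEmbedding (WithLp.toLp 2 : (Fin n → ℝ) → Rn n) :=
  (MeasurableEquiv.toLp 2 (Fin n → ℝ)).measurableEmbedding

theorem volume_cube (c : Rn n) {l : ℝ} (hl : 0 < l) :
    volume (cube c l) = ENNReal.ofReal (l ^ n) := by
  rw [← measurePreserving_toLp.measure_preimage (measurableSet_cube c l).nullMeasurableSet,
    toLp_preimage_cube c hl, Real.volume_pi_closedBall _ (by positivity)]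
  simp only [Fintype.card_fin]
  congr 2
  ring

theorem volume_cube_ne_zero (c : Rn n) {l : ℝ} (hl : 0 < l) : volume (cube c l) ≠ 0 := by
  rw [volume_cube c hl]
  exact (ENNReal.ofReal_pos.2 (by positivity)).ne'

theorem volume_cube_ne_top (c : Rn n) {l : ℝ} (hl : 0 < l) : volume (cube c l) ≠ ∞ := by
  rw [volume_cube c hl]
  exact ENNReal.ofReal_ne_top

theorem volume_cube_mul (c c' : Rn n) {a l : ℝ} (ha : 0 < a) (hl : 0 < l) :
    volume (cube c (a * l)) = ENNReal.ofReal (a ^ n) * volume (cube c' l) := by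
  rw [volume_cube c (by positivity), volume_cube c' hl, mul_pow,
    ENNReal.ofReal_mul (by positivity)]

theorem cube_subset_cube_of_le (c : Rn n) {l l' : ℝ} (h : l ≤ l') : cube c l ⊆ cube c l' :=
  fun _ hy i => (hy i).trans (by linarith)

theorem isCompact_cube (c : Rn n) {l : ℝ} (hl : 0 < l) : IsCompact (cube c l) := by
  have h := (isCompact_closedBall (WithLp.ofLp c) (l / 2)).image
    (PiLp.continuous_toLp 2 (fun _ : Fin n => ℝ))
  rw [← toLp_preimage_cube c hl, image_preimage_eq _ (WithLp.toLp_surjective 2)] at h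
  exact h

/-- Normalized Lebesgue measure on a cube. -/
noncomputable def cubeProb (c : Rn n) (l : ℝ) : Measure (Rn n) :=
  (volume (cube c l))⁻¹ • volume.restrict (cube c l)

theorem laverage_cube (c : Rn n) (l : ℝ) (f : Rn n → ℝ≥0∞) :
    ⨍⁻ y in cube c l, f y ∂volume = ∫⁻ y, f y ∂(cubeProb c l) := by
  rw [laverage, cubeProb, Measure.restrict_apply_univ]

theorem lintegral_cubeProb (c : Rn n) (l : ℝ) (f : Rn n → ℝ≥0∞) :
    ∫⁻ y, f y ∂(cubeProb c l) = (volume (cube c l))⁻¹ * ∫⁻ y in cube c l, f y := by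
  rw [cubeProb, lintegral_smul_measure, smul_eq_mul]

theorem isProbabilityMeasure_cubeProb (c : Rn n) {l : ℝ} (hl : 0 < l) :
    IsProbabilityMeasure (cubeProb c l) := by
  constructor
  rw [cubeProb, Measure.smul_apply, Measure.restrict_apply_univ, smul_eq_mul]
  exact ENNReal.inv_mul_cancel (volume_cube_ne_zero c hl) (volume_cube_ne_top c hl)

theorem cubeProb_absolutelyContinuous (c : Rn n) (l : ℝ) : cubeProb c l ≪ volume :=
  (Measure.smul_absolutelyContinuous).trans Measure.restrict_le_self.absolutelyContinuous

theorem setLIntegral_cube_eq (c : Rn n) {l : ℝ} (hl : 0 < l) (f : Rn n → ℝ≥0∞) :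
    ∫⁻ y in cube c l, f y = volume (cube c l) * ∫⁻ y, f y ∂(cubeProb c l) := by
  rw [lintegral_cubeProb, ← mul_assoc,
    ENNReal.mul_inv_cancel (volume_cube_ne_zero c hl) (volume_cube_ne_top c hl), one_mul]

theorem lintegral_cubeProb_le_of_subset {c c' : Rn n} {l a : ℝ} (hl : 0 < l) (ha : 0 < a)
    (hsub : cube c l ⊆ cube c' (a * l)) (f : Rn n → ℝ≥0∞) :
    ∫⁻ y, f y ∂(cubeProb c l) ≤ ENNReal.ofReal (a ^ n) * ∫⁻ y, f y ∂(cubeProb c' (a * l)) := by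
  rw [lintegral_cubeProb c, lintegral_cubeProb c', volume_cube_mul c' c ha hl, ← mul_assoc,
    ENNReal.mul_inv (Or.inr (volume_cube_ne_top c hl)) (Or.inr (volume_cube_ne_zero c hl)),
    ← mul_assoc, ENNReal.mul_inv_cancel (ENNReal.ofReal_pos.2 (by positivity)).ne'
    ENNReal.ofReal_ne_top, one_mul]
  gcongr

end Cubes

/-! ### Oscillation of `BMO` functions on cubes -/

section BMO

variable {n : ℕ} {𝕜 : Type*} [RCLike 𝕜]

theorem locallyIntegrable_comp_toLp {b : Rn n → 𝕜} (hb : LocallyIntegrable b volume) :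
    LocallyIntegrable (fun y : Fin n → ℝ => b (WithLp.toLp 2 y)) volume := by
  rw [locallyIntegrable_iff]
  intro S hS
  have h := hb.integrableOn_isCompact (hS.image (PiLp.continuous_toLp 2 (fun _ : Fin n => ℝ)))
  exact (measurePreserving_toLp.integrableOn_image measurableEmbedding_toLp).1 h

theorem setAverage_comp_toLp (b : Rn n → 𝕜) (c : Rn n) {l : ℝ} (hl : 0 < l) :
    ⨍ y in Metric.closedBall (WithLp.ofLp c) (l / 2), b (WithLp.toLp 2 y) =
      ⨍ y in cube c l, b y := by
  rw [← toLp_preimage_cube c hl, setAverage_eq, setAverage_eq,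
    measurePreserving_toLp.setIntegral_preimage_emb measurableEmbedding_toLp, Measure.real,
    Measure.real, measurePreserving_toLp.measure_preimage (measurableSet_cube c l).nullMeasurableSet]

theorem bmoNorm_ge (b : Rn n → 𝕜) (c : Rn n) {l : ℝ} (hl : 0 < l) :
    ∫⁻ y, ‖b y - ⨍ z in cube c l, b z‖ₑ ∂(cubeProb c l) ≤ bmoNorm b := by
  rw [← laverage_cube, bmoNorm]
  exact le_iSup_of_le c (le_iSup_of_le l (le_iSup_of_le hl le_rfl))

/-- The John–Nirenberg inequality on cubes. -/
theorem john_nirenberg_cube (n : ℕ) (𝕜 : Type*) [RCLike 𝕜] {p : ℝ} (hp : 0 < p) :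
    ∃ C : ℝ≥0∞, C ≠ ∞ ∧ ∀ b : Rn n → 𝕜, MemBMO b → ∀ (c : Rn n) (l : ℝ), 0 < l →
      (∫⁻ y, ‖b y - ⨍ z in cube c l, b z‖ₑ ^ p ∂(cubeProb c l)) ^ (1 / p) ≤ C * bmoNorm b := by
  -- Cubes are the closed balls of the sup norm, so the inequality is taken on `Fin n → ℝ` and
  -- transported along the measure-preserving map `toLp`.
  obtain ⟨C, hC, H⟩ := john_nirenberg (volume : Measure (Fin n → ℝ)) 𝕜 hp
  refine ⟨C ^ (1 / p), ENNReal.rpow_ne_top_of_nonneg (by positivity) hC, ?_⟩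
  intro b hb c l hl
  -- Working with every real `β > 0` above the norm also covers `bmoNorm b = 0`.
  refine ENNReal.le_mul_of_forall_ofReal (ENNReal.rpow_ne_top_of_nonneg (by positivity) hC)
    hb.2.ne fun β hβ0 hβ => ?_
  have h1 := H _ (locallyIntegrable_comp_toLp hb.1) β hβ0 ?_ (WithLp.ofLp c) (l / 2) (by positivity)
  · rw [setAverage_comp_toLp b c hl, ← toLp_preimage_cube c hl,
      measurePreserving_toLp.measure_preimage (measurableSet_cube c l).nullMeasurableSet,
      measurePreserving_toLp.setLIntegral_comp_preimage_emb measurableEmbedding_toLp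
        (fun y => ‖b y - ⨍ z in cube c l, b z‖ₑ ^ p), setLIntegral_cube_eq c hl, mul_comm,
      ENNReal.mul_le_mul_iff_left (volume_cube_ne_zero c hl) (volume_cube_ne_top c hl)] at h1
    calc _ ≤ (C * ENNReal.ofReal β ^ p) ^ (1 / p) := by gcongr
      _ = _ := by
        rw [ENNReal.mul_rpow_of_nonneg _ _ (by positivity), one_div, ENNReal.rpow_rpow_inv hp.ne']
  · intro c' r hr
    obtain ⟨c', rfl⟩ := WithLp.ofLp_surjective 2 c'
    obtain ⟨r, rfl⟩ : ∃ s, r = s / 2 := ⟨2 * r, by ring⟩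
    have hr' : 0 < r := by linarith
    rw [setAverage_comp_toLp b c' hr', ← toLp_preimage_cube c' hr',
      measurePreserving_toLp.measure_preimage (measurableSet_cube c' r).nullMeasurableSet,
      measurePreserving_toLp.setLIntegral_comp_preimage_emb measurableEmbedding_toLp
        (fun y => ‖b y - ⨍ z in cube c' r, b z‖ₑ), setLIntegral_cube_eq c' hr', mul_comm]
    gcongr
    exact (bmoNorm_ge b c' hr').trans hβ

/-- Telescoping over successive doublings, each of which moves the mean by at most `2^n` times the
norm. This linear growth is what the factor `k` in `∑ k C_k` has to absorb. -/
theorem enorm_average_cube_sub_le {b : Rn n → 𝕜} (hb : MemBMO b) (c : Rn n) {l : ℝ} (hl : 0 < l)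
    (k : ℕ) :
    ‖(⨍ z in cube c (2 ^ k * l), b z) - ⨍ z in cube c l, b z‖ₑ ≤ k * 2 ^ n * bmoNorm b := by
  induction k with
  | zero => simp
  | succ k ih =>
    have hk : 0 < 2 ^ k * l := by positivity
    have hk' : (2 : ℝ) ^ (k + 1) * l = 2 * (2 ^ k * l) := by ring
    have hk2 : 0 < 2 * (2 ^ k * l) := by positivity
    have hstep : ‖(⨍ z in cube c (2 ^ k * l), b z) - ⨍ z in cube c (2 ^ (k + 1) * l), b z‖ₑ ≤
        2 ^ n * bmoNorm b := by
      rw [hk']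
      have h1 := enorm_average_sub_mul_le (hb.1.integrableOn_isCompact (isCompact_cube c hk))
        (volume_cube_ne_zero c hk) (volume_cube_ne_top c hk) (⨍ z in cube c (2 * (2 ^ k * l)), b z)
      rw [setLIntegral_cube_eq c hk, mul_comm,
        ENNReal.mul_le_mul_iff_right (volume_cube_ne_zero c hk) (volume_cube_ne_top c hk)] at h1
      refine h1.trans ((lintegral_cubeProb_le_of_subset hk two_pos
        (cube_subset_cube_of_le c (by linarith)) _).trans ?_)
      rw [ENNReal.ofReal_pow zero_le_two, ENNReal.ofReal_ofNat]
      gcongr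
      exact bmoNorm_ge b c hk2
    rw [enorm_sub_rev] at hstep
    rw [← sub_add_sub_cancel _ (⨍ z in cube c (2 ^ k * l), b z)]
    refine (enorm_add_le _ _).trans ((add_le_add hstep ih).trans (le_of_eq ?_))
    push_cast
    ring

/-- `L^r` oscillation over dilated cubes around the average over the original cube. -/
theorem bmo_oscillation_dilate (n : ℕ) (𝕜 : Type*) [RCLike 𝕜] {r : ℝ} (hr : 1 ≤ r) :
    ∃ C : ℝ≥0∞, C ≠ ∞ ∧ ∀ b : Rn n → 𝕜, MemBMO b → ∀ (c : Rn n) (l : ℝ), 0 < l → ∀ k : ℕ,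
      (∫⁻ y, ‖b y - ⨍ z in cube c l, b z‖ₑ ^ r ∂(cubeProb c (2 ^ k * l))) ^ (1 / r) ≤
        C * (k + 1) * bmoNorm b := by
  have hr0 : 0 < r := by linarith
  obtain ⟨C, hC, H⟩ := john_nirenberg_cube n 𝕜 hr0
  refine ⟨C + 2 ^ n, by simp [hC], fun b hb c l hl k => ?_⟩
  have hk : 0 < 2 ^ k * l := by positivity
  have := isProbabilityMeasure_cubeProb c hk
  set κ := ⨍ z in cube c (2 ^ k * l), b z with hκ
  have hm : AEMeasurable (fun y => ‖b y - κ‖ₑ) (cubeProb c (2 ^ k * l)) :=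
    ((hb.1.aestronglyMeasurable.mono_ac (cubeProb_absolutelyContinuous c _)).sub
      aestronglyMeasurable_const).enorm
  calc (∫⁻ y, ‖b y - ⨍ z in cube c l, b z‖ₑ ^ r ∂(cubeProb c (2 ^ k * l))) ^ (1 / r)
      ≤ (∫⁻ y, ((fun y => ‖b y - κ‖ₑ) + fun _ : Rn n => ‖κ - ⨍ z in cube c l, b z‖ₑ : Rn n → ℝ≥0∞) y ^ r
          ∂(cubeProb c (2 ^ k * l))) ^ (1 / r) := by
        gcongr with y
        rw [Pi.add_apply, ← sub_add_sub_cancel (b y) κ]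
        exact enorm_add_le _ _
    _ ≤ (∫⁻ y, ‖b y - κ‖ₑ ^ r ∂(cubeProb c (2 ^ k * l))) ^ (1 / r) +
        (∫⁻ _, ‖κ - ⨍ z in cube c l, b z‖ₑ ^ r ∂(cubeProb c (2 ^ k * l))) ^ (1 / r) :=
        ENNReal.lintegral_Lp_add_le hm aemeasurable_const hr
    _ ≤ C * bmoNorm b + k * 2 ^ n * bmoNorm b := by
        gcongr
        · exact H b hb c _ hk
        · rw [lintegral_const, measure_univ, mul_one, one_div, ENNReal.rpow_rpow_inv hr0.ne']
          exact enorm_average_cube_sub_le hb c hl k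
    _ ≤ (C + 2 ^ n) * (k + 1) * bmoNorm b := by
        rw [← add_mul]
        gcongr
        calc C + k * 2 ^ n ≤ (C + k * 2 ^ n) + (C * k + 2 ^ n) := le_self_add
          _ = _ := by ring

end BMO

/-! ### Kolmogorov's inequality -/

section Kolmogorov

/-- Kolmogorov's inequality: for `δ < q` the normalized `L^δ` average over a cube is controlled by
the weak `L^q` norm. -/
theorem kolmogorov_cube (n : ℕ) (𝕜 : Type*) [RCLike 𝕜] {δ q : ℝ} (hδ : 0 < δ) (hq : δ < q) :
    ∃ C : ℝ≥0∞, C ≠ ∞ ∧ ∀ g : Rn n → 𝕜, AEStronglyMeasurable g volume → weakNorm q g ≠ ∞ →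
      ∀ (c : Rn n) (l : ℝ), 0 < l →
      (∫⁻ y, ‖g y‖ₑ ^ δ ∂(cubeProb c l)) ^ (1 / δ) ≤
        C * (volume (cube c l) ^ (-(1 / q)) * weakNorm q g) := by
  have hq0 : 0 < q := hδ.trans hq
  -- With levels `2^k τ`, the `k`-th term pairs the height `2^{(k+1)δ}` with the measure bound
  -- `2^{-qk}`; the ratio `2^{δ-q}` is below one.
  set S : ℝ≥0∞ := 1 + ∑' k : ℕ, 2 ^ δ * (2 ^ (δ - q)) ^ k with hS
  have hgeo : (2 : ℝ≥0∞) ^ (δ - q) < 1 :=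
    ENNReal.rpow_lt_one_of_one_lt_of_neg (by norm_num) (by linarith)
  have hS' : S ≠ ∞ := by
    rw [hS, ENNReal.tsum_mul_left, ENNReal.tsum_geometric]
    refine ENNReal.add_ne_top.2 ⟨ENNReal.one_ne_top, ENNReal.mul_ne_top
      (ENNReal.rpow_ne_top_of_nonneg hδ.le (by norm_num)) ?_⟩
    exact ENNReal.inv_ne_top.2 (tsub_pos_of_lt hgeo).ne'
  refine ⟨S ^ (1 / δ), ENNReal.rpow_ne_top_of_nonneg (by positivity) hS', ?_⟩
  intro g hg hW c l hl
  have hV0 := volume_cube_ne_zero c hl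
  have hVt := volume_cube_ne_top c hl
  have := isProbabilityMeasure_cubeProb c hl
  refine ENNReal.le_mul_of_forall_ofReal (ENNReal.rpow_ne_top_of_nonneg (by positivity) hS')
    (ENNReal.mul_ne_top (ENNReal.rpow_ne_top_of_ne_zero hV0 hVt) hW) fun τ hτ h => ?_
  have hWτ : weakNorm q g ≤ ENNReal.ofReal τ * volume (cube c l) ^ (1 / q) := by
    calc weakNorm q g = volume (cube c l) ^ (-(1 / q)) * weakNorm q g * volume (cube c l) ^ (1 / q) := by
          rw [mul_right_comm, ← ENNReal.rpow_add _ _ hV0 hVt]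
          simp
      _ ≤ _ := by gcongr
  have hlev : ∀ x, ∃ k : ℕ, ‖g x‖ₑ ≤ ENNReal.ofReal (2 ^ k * τ) := by
    intro x
    obtain ⟨k, hk⟩ := pow_unbounded_of_one_lt (‖g x‖ / τ) (one_lt_two)
    refine ⟨k, ?_⟩
    rw [← ofReal_norm]
    exact ENNReal.ofReal_le_ofReal ((div_le_iff₀ hτ).1 hk.le)
  have hmeas : AEMeasurable (fun y => ‖g y‖ₑ) (cubeProb c l) :=
    (hg.mono_ac (cubeProb_absolutelyContinuous c l)).enorm
  have hset : ∀ k : ℕ, (cubeProb c l) {x | ENNReal.ofReal (2 ^ k * τ) < ‖g x‖ₑ} ≤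
      (2 ^ (-q)) ^ k := by
    intro k
    have e : {x | ENNReal.ofReal (2 ^ k * τ) < ‖g x‖ₑ} = {x | 2 ^ k * τ < ‖g x‖} := by
      ext x
      rw [mem_ofPred_eq, mem_ofPred_eq, ← ofReal_norm,
        ENNReal.ofReal_lt_ofReal_iff_of_nonneg (by positivity)]
    rw [e]
    have h1 : ENNReal.ofReal (2 ^ k * τ) * volume {x | 2 ^ k * τ < ‖g x‖} ^ (1 / q) ≤
        weakNorm q g := by
      rw [weakNorm]
      exact le_iSup_of_le (2 ^ k * τ) (le_iSup_of_le (by positivity) le_rfl)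
    have h2 : volume {x | 2 ^ k * τ < ‖g x‖} ≤ volume (cube c l) * (2 ^ (-q)) ^ k := by
      have h3 := h1.trans hWτ
      rw [ENNReal.ofReal_mul (by positivity), mul_comm (ENNReal.ofReal (2 ^ k)), mul_assoc,
        ENNReal.mul_le_mul_iff_right (ENNReal.ofReal_pos.2 hτ).ne' ENNReal.ofReal_ne_top,
        ENNReal.ofReal_pow zero_le_two, ENNReal.ofReal_ofNat] at h3
      have h4 := ENNReal.rpow_le_rpow h3 hq0.le
      rw [ENNReal.mul_rpow_of_nonneg _ _ hq0.le, one_div, ENNReal.rpow_inv_rpow hq0.ne',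
        ENNReal.rpow_inv_rpow hq0.ne'] at h4
      have h5 : ((2 : ℝ≥0∞) ^ k) ^ q * (2 ^ (-q)) ^ k = 1 := by
        rw [← ENNReal.rpow_natCast, ← ENNReal.rpow_natCast, ← ENNReal.rpow_mul, ← ENNReal.rpow_mul,
          ← ENNReal.rpow_add _ _ (by norm_num) (by norm_num),
          show (k : ℝ) * q + -q * k = 0 by ring, ENNReal.rpow_zero]
      calc _ = (((2 : ℝ≥0∞) ^ k) ^ q * volume {x | 2 ^ k * τ < ‖g x‖}) * (2 ^ (-q)) ^ k := by
            rw [mul_right_comm, h5, one_mul]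
        _ ≤ _ := by gcongr
    calc (cubeProb c l) {x | 2 ^ k * τ < ‖g x‖}
        ≤ (volume (cube c l))⁻¹ * volume {x | 2 ^ k * τ < ‖g x‖} := by
          rw [cubeProb, Measure.smul_apply, smul_eq_mul]
          gcongr
          exact Measure.restrict_le_self
      _ ≤ (volume (cube c l))⁻¹ * (volume (cube c l) * (2 ^ (-q)) ^ k) := by gcongr
      _ = _ := by rw [← mul_assoc, ENNReal.inv_mul_cancel hV0 hVt, one_mul]
  have hmain : ∫⁻ y, ‖g y‖ₑ ^ δ ∂(cubeProb c l) ≤ S * ENNReal.ofReal τ ^ δ := by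
    refine (lintegral_rpow_le_of_levels hmeas hlev hδ.le).trans ?_
    rw [measure_univ, mul_one, hS, add_mul, pow_zero, one_mul, one_mul, ← ENNReal.tsum_mul_right]
    gcongr 1
    refine ENNReal.tsum_le_tsum fun k => ?_
    calc ENNReal.ofReal (2 ^ (k + 1) * τ) ^ δ * _
        ≤ ENNReal.ofReal (2 ^ (k + 1) * τ) ^ δ * (2 ^ (-q)) ^ k := by
          gcongr
          exact hset k
      _ = 2 ^ δ * (2 ^ (δ - q)) ^ k * ENNReal.ofReal τ ^ δ := by
          rw [ENNReal.ofReal_mul (by positivity), ENNReal.mul_rpow_of_nonneg _ _ hδ.le,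
            ENNReal.ofReal_pow zero_le_two, ENNReal.ofReal_ofNat, sub_eq_add_neg δ q,
            ENNReal.rpow_add _ _ (by norm_num) (by norm_num), mul_pow, pow_succ,
            ENNReal.mul_rpow_of_nonneg _ _ hδ.le, ← ENNReal.rpow_natCast (2 ^ δ),
            ← ENNReal.rpow_natCast 2 k, ← ENNReal.rpow_mul, ← ENNReal.rpow_mul, mul_comm δ]
          ring
  calc _ ≤ (S * ENNReal.ofReal τ ^ δ) ^ (1 / δ) := by gcongr
    _ = _ := by
      rw [ENNReal.mul_rpow_of_nonneg _ _ (by positivity), one_div, ENNReal.rpow_rpow_inv hδ.ne']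

end Kolmogorov

end FracMultilinear

namespace FracMultilinear

/-! ### Approximation by Schwartz functions with controlled support -/

section Approximation

variable {n : ℕ} {𝕜 : Type*} [RCLike 𝕜]

open scoped Manifold in
theorem exists_smooth_cutoff {S : Set (Rn n)} (hS : IsCompact S) {ε : ℝ} (hε : 0 < ε) :
    ∃ χ : Rn n → ℝ, ContDiff ℝ (⊤ : ℕ∞) χ ∧ HasCompactSupport χ ∧
      tsupport χ ⊆ Metric.cthickening ε S ∧ (∀ y ∈ S, χ y = 1) ∧ ∀ y, ‖χ y‖ ≤ 1 := by
  have hd : Disjoint (Metric.thickening ε S)ᶜ S :=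
    disjoint_compl_left_iff_subset.2 (Metric.self_subset_thickening hε S)
  obtain ⟨f, hf0, hf1, hf⟩ := exists_contMDiffMap_zero_one_of_isClosed (n := (⊤ : ℕ∞)) 𝓘(ℝ, Rn n)
    Metric.isOpen_thickening.isClosed_compl hS.isClosed hd
  have hsub : tsupport f ⊆ Metric.cthickening ε S := by
    refine closure_minimal (fun y hy => ?_) Metric.isClosed_cthickening
    by_contra h
    exact hy (hf0 fun h' => h (Metric.thickening_subset_cthickening ε S h'))
  refine ⟨f, f.contMDiff.contDiff, ?_, hsub, fun y hy => hf1 hy, fun y => ?_⟩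
  · exact hS.cthickening.of_isClosed_subset (isClosed_tsupport _) hsub
  · rw [Real.norm_eq_abs, abs_of_nonneg (hf y).1]
    exact (hf y).2

/-- Density of Schwartz functions in `L^p`, followed by multiplication by a cutoff `χ` equal to one
on the support of `h`. Since `χ h = h` and `|χ| ≤ 1`, the cutoff does not increase the error, and it
keeps the approximant away from points at distance more than `ε` from the support of `h`. -/
theorem exists_schwartz_approx {h : Rn n → 𝕜} {p : ℝ} (hp : 1 ≤ p)
    (hh : MemLp h (ENNReal.ofReal p) volume) (hc : HasCompactSupport h) {ε : ℝ} (hε : 0 < ε)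
    {η : ℝ≥0∞} (hη : η ≠ 0) :
    ∃ φ : 𝓢(Rn n, 𝕜), tsupport φ ⊆ Metric.cthickening ε (tsupport h) ∧
      HasCompactSupport φ ∧ eLpNorm (⇑φ - h) (ENNReal.ofReal p) volume ≤ η := by
  have : Fact (1 ≤ ENNReal.ofReal p) := ⟨by simpa using ENNReal.ofReal_le_ofReal hp⟩
  obtain ⟨χ, hχ, hχc, hχs, hχ1, hχn⟩ := exists_smooth_cutoff (S := tsupport h) hc hε
  obtain ⟨ψ, hψ⟩ := (SchwartzMap.denseRange_toLpCLM (F := 𝕜) (μ := (volume : Measure (Rn n)))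
    (p := ENNReal.ofReal p) ENNReal.ofReal_ne_top).exists_mem_open
    (Metric.isOpen_eball (x := hh.toLp h) (ε := η))
    ⟨hh.toLp h, Metric.mem_eball_self (pos_iff_ne_zero.2 hη)⟩
  have hψ' : eLpNorm (⇑ψ - h) (ENNReal.ofReal p) volume ≤ η := by
    have h1 : edist ((ψ.memLp (ENNReal.ofReal p) volume).toLp ψ) (hh.toLp h) < η := hψ
    rw [Lp.edist_toLp_toLp] at h1
    exact h1.le
  have hcs : HasCompactSupport fun y => χ y • ψ y := hχc.smul_right
  refine ⟨hcs.toSchwartzMap (hχ.smul (ψ.smooth _)), ?_, hcs, ?_⟩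
  · exact (closure_mono (Function.support_smul_subset_left χ ψ)).trans hχs
  · refine (eLpNorm_mono fun y => ?_).trans hψ'
    have h1 : χ y • h y = h y := by
      by_cases hy : y ∈ tsupport h
      · rw [hχ1 y hy, one_smul]
      · rw [image_eq_zero_of_notMem_tsupport hy, smul_zero]
    change ‖χ y • ψ y - h y‖ ≤ ‖ψ y - h y‖
    rw [← h1, ← smul_sub, norm_smul, h1]
    exact mul_le_of_le_one_left (norm_nonneg _) (hχn y)

theorem eLpNorm_one_le_of_support_subset {W : Set (Rn n)} {g : Rn n → 𝕜}
    (hg : AEStronglyMeasurable g volume) (hsub : Function.support g ⊆ W) {p : ℝ} (hp : 1 ≤ p) :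
    eLpNorm g 1 volume ≤
      eLpNorm g (ENNReal.ofReal p) volume * volume W ^ (1 - 1 / p) := by
  rw [← eLpNorm_restrict_eq_of_support_subset hsub]
  refine (eLpNorm_le_eLpNorm_mul_rpow_measure_univ (q := ENNReal.ofReal p)
    (by simpa using ENNReal.ofReal_le_ofReal hp) hg.restrict).trans ?_
  rw [Measure.restrict_apply_univ, ENNReal.toReal_ofReal (by linarith), ENNReal.toReal_one, div_one]
  gcongr
  exact Measure.restrict_le_self

end Approximation

/-! ### Tonelli's theorem for products of functions of separate variables -/

section Product

theorem lintegral_prod_enorm_eq {ι X : Type*} [Fintype ι] [MeasurableSpace X] {μ : Measure X}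
    [SigmaFinite μ] {F : Type*} [NormedAddCommGroup F] {u : ι → X → F}
    (hu : ∀ j, Integrable (u j) μ) :
    ∫⁻ y : ι → X, ∏ j, ‖u j (y j)‖ₑ ∂(Measure.pi fun _ => μ) = ∏ j, ∫⁻ x, ‖u j x‖ₑ ∂μ := by
  have h1 : Integrable (fun y : ι → X => ∏ j, ‖u j (y j)‖) (Measure.pi fun _ => μ) :=
    Integrable.fintype_prod (f := fun j x => ‖u j x‖) fun j => (hu j).norm
  have h2 := ofReal_integral_norm_eq_lintegral_enorm h1
  have h3 : ∀ y : ι → X, ‖∏ j, ‖u j (y j)‖‖ = ∏ j, ‖u j (y j)‖ := fun y => by simp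
  have h4 : ∀ y : ι → X, ‖∏ j, ‖u j (y j)‖‖ₑ = ∏ j, ‖u j (y j)‖ₑ := fun y => by
    rw [← ofReal_norm, h3, ENNReal.ofReal_prod_of_nonneg fun _ _ => norm_nonneg _]
    simp
  simp_rw [h3, h4] at h2
  rw [← h2, integral_fintype_prod_eq_prod (fun j x => ‖u j x‖),
    ENNReal.ofReal_prod_of_nonneg fun _ _ => integral_nonneg fun _ => norm_nonneg _]
  exact Finset.prod_congr rfl fun j _ => ofReal_integral_norm_eq_lintegral_enorm (hu j)

end Product

/-! ### Measurability of the slices of the kernel -/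

section KernelMeasurability

variable {n m : ℕ} {𝕜 : Type*} [RCLike 𝕜]

/-- Only joint measurability off the diagonal is known. Almost every slice of the extension by zero
is measurable, and a slice meets the diagonal in a single point, which is null because `n` and `m`
are positive. -/
theorem IsFracKernel.ae_aestronglyMeasurable {α : ℝ} {K : Rn n → (Fin m → Rn n) → 𝕜}
    (hK : IsFracKernel α K) (hn : 0 < n) (hm : 0 < m) :
    ∀ᵐ z ∂(volume : Measure (Rn n)), AEStronglyMeasurable (K z) volume := by
  set U : Set (Rn n × (Fin m → Rn n)) := {p | ¬ ∀ j, p.2 j = p.1} with hU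
  have hUo : IsOpen U := by
    have : IsClosed {p : Rn n × (Fin m → Rn n) | ∀ j, p.2 j = p.1} := by
      simp only [ofPred_forall]
      exact isClosed_iInter fun j => isClosed_eq (by fun_prop) (by fun_prop)
    exact this.isOpen_compl
  have h1 : AEStronglyMeasurable (U.indicator (Function.uncurry K))
      ((volume : Measure (Rn n)).prod (volume : Measure (Fin m → Rn n))) :=
    (aestronglyMeasurable_indicator_iff hUo.measurableSet).2
      hK.locallyIntegrable.aestronglyMeasurable
  have : Nonempty (Fin n) := ⟨⟨0, hn⟩⟩
  have : Nonempty (Fin m) := ⟨⟨0, hm⟩⟩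
  have : NullSingletonClass (volume : Measure (Fin m → Rn n)) := by
    rw [volume_pi]
    exact Measure.pi_nullSingletonClass ⟨0, hm⟩
  filter_upwards [h1.prodMk_left] with z hz
  refine hz.congr ?_
  have h0 : ∀ᵐ y ∂(volume : Measure (Fin m → Rn n)), y ≠ fun _ => z := by
    simp [ae_iff]
  filter_upwards [h0] with y hy
  rw [indicator_of_mem]
  · rfl
  · exact fun h => hy (funext h)

end KernelMeasurability

/-! ### The operator on tuples of functions -/

section ApplyFun

variable {n m : ℕ} {𝕜 : Type*} [RCLike 𝕜] {s : Fin m → ℝ} (T : LpMultilinear n m 𝕜 s)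

theorem applyFun_of_memLp {h : Fin m → Rn n → 𝕜}
    (hh : ∀ j, MemLp (h j) (ENNReal.ofReal (s j)) (volume : Measure (Rn n))) :
    applyFun T h = T fun j => (hh j).toLp (h j) := by
  simp only [applyFun, dif_pos hh]

theorem memLp_update {h : Fin m → Rn n → 𝕜}
    (hh : ∀ j, MemLp (h j) (ENNReal.ofReal (s j)) (volume : Measure (Rn n))) {i : Fin m}
    {u : Rn n → 𝕜} (hu : MemLp u (ENNReal.ofReal (s i)) volume) (j : Fin m) :
    MemLp (Function.update h i u j) (ENNReal.ofReal (s j)) volume := by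
  rcases eq_or_ne j i with rfl | hj
  · simpa using hu
  · simpa [hj] using hh j

theorem applyFun_update {h : Fin m → Rn n → 𝕜}
    (hh : ∀ j, MemLp (h j) (ENNReal.ofReal (s j)) (volume : Measure (Rn n))) {i : Fin m}
    {u : Rn n → 𝕜} (hu : MemLp u (ENNReal.ofReal (s i)) volume) :
    applyFun T (Function.update h i u) =
      T (Function.update (fun j => (hh j).toLp (h j)) i (hu.toLp u)) := by
  rw [applyFun_of_memLp T (memLp_update hh hu)]
  congr 2
  ext1 j
  rcases eq_or_ne j i with rfl | hj
  · simp
  · simp [hj]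

theorem aestronglyMeasurable_applyFun (h : Fin m → Rn n → 𝕜) :
    AEStronglyMeasurable (applyFun T h) volume := by
  rw [applyFun]
  split_ifs
  · exact AEEqFun.aestronglyMeasurable _
  · exact aestronglyMeasurable_zero

theorem applyFun_update_sub {h : Fin m → Rn n → 𝕜}
    (hh : ∀ j, MemLp (h j) (ENNReal.ofReal (s j)) (volume : Measure (Rn n))) {i : Fin m}
    {u v : Rn n → 𝕜} (hu : MemLp u (ENNReal.ofReal (s i)) volume)
    (hv : MemLp v (ENNReal.ofReal (s i)) volume) :
    applyFun T (Function.update h i (u - v)) =ᵐ[volume]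
      applyFun T (Function.update h i u) - applyFun T (Function.update h i v) := by
  rw [applyFun_update T hh hu, applyFun_update T hh hv, applyFun_update T hh (hu.sub hv),
    MemLp.toLp_sub, MultilinearMap.map_update_sub]
  exact AEEqFun.coeFn_sub _ _

theorem applyFun_update_smul {h : Fin m → Rn n → 𝕜}
    (hh : ∀ j, MemLp (h j) (ENNReal.ofReal (s j)) (volume : Measure (Rn n))) {i : Fin m}
    {u : Rn n → 𝕜} (hu : MemLp u (ENNReal.ofReal (s i)) volume) (a : 𝕜) :
    applyFun T (Function.update h i (a • u)) =ᵐ[volume]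
      a • applyFun T (Function.update h i u) := by
  rw [applyFun_update T hh hu, applyFun_update T hh (hu.const_smul a),
    MemLp.toLp_const_smul, MultilinearMap.map_update_smul]
  exact AEEqFun.coeFn_smul _ _

theorem applyFun_add_eq_sum {g g' : Fin m → Rn n → 𝕜}
    (hg : ∀ j, MemLp (g j) (ENNReal.ofReal (s j)) (volume : Measure (Rn n)))
    (hg' : ∀ j, MemLp (g' j) (ENNReal.ofReal (s j)) (volume : Measure (Rn n))) :
    applyFun T (g + g') =ᵐ[volume]
      fun z => ∑ J : Finset (Fin m), applyFun T (J.piecewise g g') z := by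
  have hp : ∀ (J : Finset (Fin m)) (j : Fin m),
      MemLp (J.piecewise g g' j) (ENNReal.ofReal (s j)) (volume : Measure (Rn n)) := by
    intro J j
    by_cases hj : j ∈ J
    · simpa [hj] using hg j
    · simpa [hj] using hg' j
  have e1 : applyFun T (g + g') =
      T ((fun j => (hg j).toLp (g j)) + fun j => (hg' j).toLp (g' j)) := by
    rw [applyFun_of_memLp T (h := g + g') fun j => (hg j).add (hg' j)]
    rfl
  have e2 : ∀ J : Finset (Fin m), applyFun T (J.piecewise g g') =
      T (J.piecewise (fun j => (hg j).toLp (g j)) fun j => (hg' j).toLp (g' j)) := by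
    intro J
    rw [applyFun_of_memLp T (hp J)]
    congr 2
    ext1 j
    by_cases hj : j ∈ J <;> simp [hj]
  simp_rw [e1, e2, MultilinearMap.map_add_univ]
  refine (AEEqFun.coeFn_finsetSum _ _).trans (Eventually.of_forall fun z => ?_)
  simp

theorem weakNorm_applyFun_le {q B : ℝ}
    (hB : ∀ f : (j : Fin m) → Lp 𝕜 (ENNReal.ofReal (s j)) (volume : Measure (Rn n)),
      weakNorm q (T f) ≤ ENNReal.ofReal B * ∏ j, eLpNorm (f j) (ENNReal.ofReal (s j)) volume)
    {h : Fin m → Rn n → 𝕜}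
    (hh : ∀ j, MemLp (h j) (ENNReal.ofReal (s j)) (volume : Measure (Rn n))) :
    weakNorm q (applyFun T h) ≤
      ENNReal.ofReal B * ∏ j, eLpNorm (h j) (ENNReal.ofReal (s j)) volume := by
  rw [applyFun_of_memLp T hh]
  refine (hB _).trans_eq ?_
  congr 1
  exact Finset.prod_congr rfl fun j _ => eLpNorm_congr_ae (hh j).coeFn_toLp

theorem HasKernel.applyFun_eq {K : Rn n → (Fin m → Rn n) → 𝕜} {T : LpMultilinear n m 𝕜 s}
    (hT : HasKernel T K) {h : Fin m → Rn n → 𝕜} (φ : Fin m → 𝓢(Rn n, 𝕜))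
    (hφ : ∀ j, h j = φ j) :
    ∀ᵐ z ∂(volume : Measure (Rn n)), z ∉ ⋂ j, tsupport (h j) →
      applyFun T h z = ∫ y : Fin m → Rn n, K z y * ∏ j, h j (y j) := by
  obtain rfl : h = fun j => (φ j : Rn n → 𝕜) := funext hφ
  rw [applyFun_of_memLp T fun j => (φ j).memLp _ _]
  exact hT φ

theorem tendstoInMeasure_of_weakNorm {q : ℝ} (hq : 0 < q) {f : ℕ → Rn n → 𝕜} {g : Rn n → 𝕜}
    (h : Tendsto (fun k => weakNorm q (f k - g)) atTop (𝓝 0)) :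
    TendstoInMeasure volume f atTop g := by
  rw [tendstoInMeasure_iff_norm]
  intro ε hε
  have h1 : Tendsto (fun k => (weakNorm q (f k - g) * (ENNReal.ofReal (ε / 2))⁻¹) ^ q) atTop
      (𝓝 0) := by
    have h2 := ENNReal.Tendsto.mul_const (b := (ENNReal.ofReal (ε / 2))⁻¹) h
      (Or.inr (ENNReal.inv_ne_top.2 (ENNReal.ofReal_pos.2 (by linarith)).ne'))
    rw [zero_mul] at h2
    have h3 := h2.ennrpow_const q
    rwa [ENNReal.zero_rpow_of_pos hq] at h3
  refine tendsto_of_tendsto_of_tendsto_of_le_of_le tendsto_const_nhds h1 (fun _ => zero_le)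
    fun k => ?_
  -- The weak norm involves strict superlevel sets, so the level is lowered to `ε / 2`.
  have h4 : ENNReal.ofReal (ε / 2) * (volume {x | ε / 2 < ‖(f k - g) x‖}) ^ (1 / q) ≤
      weakNorm q (f k - g) := by
    rw [weakNorm]
    exact le_iSup_of_le (ε / 2) (le_iSup_of_le (by linarith) le_rfl)
  calc volume {x | ε ≤ ‖f k x - g x‖} ≤ volume {x | ε / 2 < ‖(f k - g) x‖} :=
        measure_mono fun x (hx : ε ≤ _) => lt_of_lt_of_le (by linarith) hx
    _ = ((volume {x | ε / 2 < ‖(f k - g) x‖}) ^ (1 / q)) ^ q := by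
        rw [one_div, ENNReal.rpow_inv_rpow hq.ne']
    _ ≤ _ := by
        gcongr
        rw [← div_eq_mul_inv, ENNReal.le_div_iff_mul_le
          (Or.inl (ENNReal.ofReal_pos.2 (by linarith)).ne') (Or.inl ENNReal.ofReal_ne_top), mul_comm]
        exact h4

end ApplyFun

end FracMultilinear

namespace FracMultilinear

/-! ### Extension of the kernel representation beyond Schwartz functions -/

section Representation

variable {n m : ℕ} {𝕜 : Type*} [RCLike 𝕜]

theorem norm_kernel_le {K : Rn n → (Fin m → Rn n) → 𝕜} {A e : ℝ} (hA0 : 0 < A) (he : 0 ≤ e)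
    (hA : ∀ (x : Rn n) (y : Fin m → Rn n), (¬ ∀ j, y j = x) →
      ‖K x y‖ ≤ A / (∑ j, ‖x - y j‖) ^ e)
    {z : Rn n} {y : Fin m → Rn n} {j : Fin m} {ε : ℝ} (hε : 0 < ε) (h : ε ≤ dist z (y j)) :
    ‖K z y‖ ≤ A / ε ^ e := by
  have h1 : ¬ ∀ j, y j = z := fun h' => by
    rw [h' j, dist_self] at h
    linarith
  refine (hA z y h1).trans ?_
  have h2 : ε ≤ ∑ j, ‖z - y j‖ := by
    rw [dist_eq_norm] at h
    exact h.trans (Finset.single_le_sum (f := fun j => ‖z - y j‖) (fun _ _ => norm_nonneg _)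
      (Finset.mem_univ j))
  gcongr

theorem lintegral_mul_prod_le {k : (Fin m → Rn n) → 𝕜}
    {h : Fin m → Rn n → 𝕜} (hh : ∀ j, Integrable (h j) volume) {A : ℝ}
    (hA : ∀ y : Fin m → Rn n, (∀ j, h j (y j) ≠ 0) → ‖k y‖ ≤ A) :
    ∫⁻ y, ‖k y * ∏ j, h j (y j)‖ₑ ≤ ENNReal.ofReal A * ∏ j, ∫⁻ x, ‖h j x‖ₑ := by
  rw [← lintegral_prod_enorm_eq hh, ← lintegral_const_mul' _ _ ENNReal.ofReal_ne_top, volume_pi]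
  refine lintegral_mono fun y => ?_
  have e : ∏ j, ‖h j (y j)‖ₑ = ‖∏ j, h j (y j)‖ₑ := by
    rw [← ofReal_norm, norm_prod, ENNReal.ofReal_prod_of_nonneg fun _ _ => norm_nonneg _]
    simp
  rw [enorm_mul]
  by_cases hy : ∀ j, h j (y j) ≠ 0
  · rw [e]
    gcongr
    rw [← ofReal_norm]
    exact ENNReal.ofReal_le_ofReal (hA y hy)
  · push Not at hy
    obtain ⟨j, hj⟩ := hy
    rw [Finset.prod_eq_zero (Finset.mem_univ j) hj]
    simp

theorem integrable_mul_prod {k : (Fin m → Rn n) → 𝕜} (hk : AEStronglyMeasurable k volume)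
    {h : Fin m → Rn n → 𝕜} (hh : ∀ j, Integrable (h j) volume) {A : ℝ}
    (hA : ∀ y : Fin m → Rn n, (∀ j, h j (y j) ≠ 0) → ‖k y‖ ≤ A) :
    Integrable (fun y => k y * ∏ j, h j (y j)) volume := by
  refine ⟨hk.mul (Integrable.fintype_prod hh).aestronglyMeasurable, ?_⟩
  refine (lintegral_mul_prod_le hh hA).trans_lt (ENNReal.mul_lt_top ENNReal.ofReal_lt_top ?_)
  exact ENNReal.prod_lt_top fun j _ => (hh j).2

theorem integrable_of_memLp_of_hasCompactSupport {h : Rn n → 𝕜} {p : ℝ} (hp : 1 ≤ p)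
    (hh : MemLp h (ENNReal.ofReal p) volume) (hc : HasCompactSupport h) : Integrable h volume := by
  rw [← memLp_one_iff_integrable]
  refine ⟨hh.1, (eLpNorm_one_le_of_support_subset hh.1 (subset_tsupport h) hp).trans_lt ?_⟩
  refine ENNReal.mul_lt_top hh.2 (ENNReal.rpow_lt_top_of_nonneg ?_ hc.measure_lt_top.ne)
  rw [sub_nonneg]
  exact (div_le_one (by linarith)).2 hp

theorem prod_update_sub (h : Fin m → Rn n → 𝕜) (i : Fin m) (u : Rn n → 𝕜) (y : Fin m → Rn n) :
    ∏ j, Function.update h i (u - h i) j (y j) =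
      ∏ j, Function.update h i u j (y j) - ∏ j, h j (y j) := by
  have e : ∀ w : Rn n → 𝕜, ∏ j, Function.update h i w j (y j) =
      w (y i) * ∏ j ∈ Finset.univ.erase i, h j (y j) := by
    intro w
    rw [← Finset.mul_prod_erase _ _ (Finset.mem_univ i)]
    congr 1
    · simp
    · exact Finset.prod_congr rfl fun j hj => by simp [(Finset.mem_erase.1 hj).1]
  rw [e, e, ← Finset.mul_prod_erase Finset.univ (fun j => h j (y j)) (Finset.mem_univ i), Pi.sub_apply]
  ring

/-- The kernel representation extends from Schwartz functions to compactly supported functions in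
the domain of the operator, on any set at positive distance from the support of one of the
entries. -/
theorem applyFun_eq_integral {s : Fin m → ℝ} {T : LpMultilinear n m 𝕜 s}
    {K : Rn n → (Fin m → Rn n) → 𝕜} {α q : ℝ}
    (hn : 0 < n) (hs : ∀ j, 1 ≤ s j) (hα : α ≤ (m : ℝ) * n)
    (hq : 0 < q) (hK : IsFracKernel α K) (hTK : HasKernel T K) (hT : WeakBounded T q)
    {S : Set (Rn n)} {j₀ : Fin m} (J : Finset (Fin m)) :
    ∀ ε : ℝ, 0 < ε → ∀ h : Fin m → Rn n → 𝕜,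
      (∀ j, MemLp (h j) (ENNReal.ofReal (s j)) (volume : Measure (Rn n))) →
      (∀ j, HasCompactSupport (h j)) → (∀ j ∉ J, ∃ φ : 𝓢(Rn n, 𝕜), h j = φ) →
      (∀ z ∈ S, ∀ w ∈ tsupport (h j₀), ε ≤ dist z w) →
      ∀ᵐ z ∂(volume : Measure (Rn n)), z ∈ S →
        applyFun T h z = ∫ y : Fin m → Rn n, K z y * ∏ j, h j (y j) := by
  have hKmeas := hK.ae_aestronglyMeasurable hn j₀.pos
  obtain ⟨A, hA0, hA⟩ := hK.size
  obtain ⟨B, hB0, hB⟩ := hT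
  have he : 0 ≤ (m : ℝ) * n - α := by linarith
  -- Induction on the set of entries not required to be Schwartz; one entry at a time is
  -- approximated. Both `ε` and `h` stay universally quantified, since a replacement changes the
  -- tuple and may halve the distance to the support.
  induction J using Finset.induction_on with
  | empty =>
    intro ε hε h _ _ hφ hdist
    choose φ hφ using fun j => hφ j (Finset.notMem_empty j)
    filter_upwards [hTK.applyFun_eq φ hφ] with z hz hzS
    refine hz fun hmem => ?_
    have h1 := hdist z hzS z (mem_iInter.1 hmem j₀)
    rw [dist_self] at h1
    linarith
  | insert i J hi ih =>
    intro ε hε h hh hc hφ hdist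
    have happrox : ∀ k : ℕ, ∃ φ : 𝓢(Rn n, 𝕜),
        tsupport φ ⊆ Metric.cthickening (ε / 2) (tsupport (h i)) ∧ HasCompactSupport φ ∧
        eLpNorm (⇑φ - h i) (ENNReal.ofReal (s i)) volume ≤ ((k : ℝ≥0∞) + 1)⁻¹ := fun k =>
      exists_schwartz_approx (hs i) (hh i) (hc i) (by linarith) (by simp)
    choose φ hφs hφc hφn using happrox
    have hφm : ∀ k, MemLp (φ k) (ENNReal.ofReal (s i)) (volume : Measure (Rn n)) := fun k =>
      (φ k).memLp _ _
    have hlim : Tendsto (fun k => eLpNorm (⇑(φ k) - h i) (ENNReal.ofReal (s i)) volume) atTop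
        (𝓝 0) := by
      refine tendsto_of_tendsto_of_tendsto_of_le_of_le tendsto_const_nhds ?_ (fun _ => zero_le) hφn
      exact_mod_cast (tendsto_add_atTop_iff_nat 1).2 ENNReal.tendsto_inv_nat_nhds_zero
    set W := Metric.cthickening (ε / 2) (tsupport (h i)) with hW
    have hWc : IsCompact W := IsCompact.cthickening (hc i)
    have hlim1 : Tendsto (fun k => eLpNorm (⇑(φ k) - h i) 1 volume) atTop (𝓝 0) := by
      have hWt : volume W ^ (1 - 1 / s i) ≠ ∞ := by
        refine ENNReal.rpow_ne_top_of_nonneg ?_ hWc.measure_lt_top.ne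
        rw [sub_nonneg]
        exact (div_le_one (by linarith [hs i])).2 (hs i)
      have h1 := ENNReal.Tendsto.mul_const (b := volume W ^ (1 - 1 / s i)) hlim (Or.inr hWt)
      rw [zero_mul] at h1
      refine tendsto_of_tendsto_of_tendsto_of_le_of_le tendsto_const_nhds h1 (fun _ => zero_le)
        fun k => eLpNorm_one_le_of_support_subset ((hφm k).sub (hh i)).1 ?_ (hs i)
      refine (Function.support_sub _ _).trans (union_subset ?_ ?_)
      · exact (subset_tsupport _).trans (hφs k)
      · exact (subset_tsupport _).trans (Metric.self_subset_cthickening _)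
    -- The tuples differ in one entry, so the weak-type bound gives convergence of the operator side
    -- in weak `L^q`, hence in measure, hence almost everywhere along a subsequence.
    have hweak : Tendsto (fun k => weakNorm q (applyFun T (Function.update h i (⇑(φ k) - h i))))
        atTop (𝓝 0) := by
      have hprod : ∀ k, ∏ j, eLpNorm (Function.update h i (⇑(φ k) - h i) j)
          (ENNReal.ofReal (s j)) volume = eLpNorm (⇑(φ k) - h i) (ENNReal.ofReal (s i)) volume *
            ∏ j ∈ Finset.univ.erase i, eLpNorm (h j) (ENNReal.ofReal (s j)) volume := by
        intro k
        rw [← Finset.mul_prod_erase _ _ (Finset.mem_univ i)]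
        congr 1
        · simp
        · exact Finset.prod_congr rfl fun j hj => by simp [(Finset.mem_erase.1 hj).1]
      have h1 := ENNReal.Tendsto.const_mul (a := ENNReal.ofReal B) (ENNReal.Tendsto.mul_const
        (b := ∏ j ∈ Finset.univ.erase i, eLpNorm (h j) (ENNReal.ofReal (s j)) volume) hlim
        (Or.inr (ENNReal.prod_ne_top fun j _ => (hh j).2.ne))) (Or.inr ENNReal.ofReal_ne_top)
      rw [zero_mul, mul_zero] at h1
      refine tendsto_of_tendsto_of_tendsto_of_le_of_le tendsto_const_nhds h1 (fun _ => zero_le)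
        fun k => ?_
      have h2 := weakNorm_applyFun_le T hB (memLp_update hh ((hφm k).sub (hh i)))
      rwa [hprod] at h2
    have hweak' : Tendsto (fun k => weakNorm q
        (applyFun T (Function.update h i (φ k)) - applyFun T h)) atTop (𝓝 0) := by
      refine hweak.congr fun k => ?_
      have h1 := applyFun_update_sub T hh (hφm k) (hh i)
      rw [Function.update_eq_self] at h1
      simp only [weakNorm]
      refine iSup_congr fun a => iSup_congr fun _ => ?_
      congr 2
      refine measure_congr ?_
      filter_upwards [h1] with x hx
      apply propext
      change a < _ ↔ a < _
      rw [hx]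
    obtain ⟨ns, hns, hae⟩ := (tendstoInMeasure_of_weakNorm hq hweak').exists_seq_tendsto_ae
    have hupd : ∀ k, ∀ᵐ z ∂(volume : Measure (Rn n)), z ∈ S →
        applyFun T (Function.update h i (φ k)) z =
          ∫ y : Fin m → Rn n, K z y * ∏ j, Function.update h i (φ k) j (y j) := by
      intro k
      refine ih (ε / 2) (by linarith) _ (memLp_update hh (hφm k)) ?_ ?_ ?_
      · intro j
        rcases eq_or_ne j i with rfl | hj
        · simpa using hφc k
        · simpa [hj] using hc j
      · intro j hjJ
        rcases eq_or_ne j i with rfl | hj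
        · exact ⟨φ k, by simp⟩
        · simpa [hj] using hφ j (by simp [hj, hjJ])
      · intro z hz w hw
        rcases eq_or_ne j₀ i with rfl | hj
        · rw [Function.update_self] at hw
          have h1 := hφs k hw
          rw [hW, IsCompact.cthickening_eq_biUnion_closedBall (hc j₀) (by linarith)] at h1
          obtain ⟨w', hw', hd⟩ := mem_iUnion₂.1 h1
          have h2 := hdist z hz w' hw'
          rw [Metric.mem_closedBall] at hd
          linarith [dist_triangle z w w']
        · rw [Function.update_of_ne hj] at hw
          linarith [hdist z hz w hw]
    filter_upwards [hae, ae_all_iff.2 hupd, hKmeas] with z hz1 hz2 hz3 hzS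
    refine tendsto_nhds_unique hz1 ?_
    have hint : ∀ j, Integrable (h j) volume := fun j =>
      integrable_of_memLp_of_hasCompactSupport (hs j) (hh j) (hc j)
    have hφi : ∀ k, Integrable (φ k) (volume : Measure (Rn n)) := fun k =>
      integrable_of_memLp_of_hasCompactSupport (hs i) (hφm k) (hφc k)
    have hupdi : ∀ u : Rn n → 𝕜, Integrable u volume →
        ∀ j, Integrable (Function.update h i u j) (volume : Measure (Rn n)) := by
      intro u hu j
      rcases eq_or_ne j i with rfl | hj
      · simpa using hu
      · simpa [hj] using hint j
    have hbound : ∀ u : Rn n → 𝕜, Function.support u ⊆ W → ∀ y : Fin m → Rn n,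
        (∀ j, Function.update h i u j (y j) ≠ 0) →
        ‖K z y‖ ≤ A / (ε / 2) ^ ((m : ℝ) * n - α) := by
      intro u hu y hy
      refine norm_kernel_le hA0 he hA (j := j₀) (by linarith) ?_
      have h0 := hy j₀
      rcases eq_or_ne j₀ i with rfl | hj
      · rw [Function.update_self] at h0
        have h1 := hu h0
        rw [hW, IsCompact.cthickening_eq_biUnion_closedBall (hc j₀) (by linarith)] at h1
        obtain ⟨w', hw', hd⟩ := mem_iUnion₂.1 h1
        have h2 := hdist z hzS w' hw'
        rw [Metric.mem_closedBall] at hd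
        linarith [dist_triangle z (y j₀) w']
      · rw [Function.update_of_ne hj] at h0
        linarith [hdist z hzS (y j₀) (subset_tsupport _ h0)]
    have hsW : Function.support (h i) ⊆ W :=
      (subset_tsupport _).trans (Metric.self_subset_cthickening _)
    have hφW : ∀ k, Function.support (φ k) ⊆ W := fun k => (subset_tsupport _).trans (hφs k)
    have hI0 : Integrable (fun y => K z y * ∏ j, h j (y j)) volume := by
      have h1 := integrable_mul_prod hz3 (hupdi (h i) (hint i)) (hbound (h i) hsW)
      rwa [Function.update_eq_self] at h1
    have hIk : ∀ k, Integrable (fun y => K z y * ∏ j, Function.update h i (φ k) j (y j)) volume :=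
      fun k => integrable_mul_prod hz3 (hupdi _ (hφi k)) (hbound _ (hφW k))
    -- Where the products do not vanish, the `j₀`-th variable is at distance at least `ε / 2` from
    -- `z`, so the kernel is bounded there and `L¹` convergence of the `i`-th entry passes to the
    -- integrals.
    have hconv : Tendsto (fun k => ∫ y : Fin m → Rn n,
        K z y * ∏ j, Function.update h i (φ k) j (y j)) atTop
        (𝓝 (∫ y : Fin m → Rn n, K z y * ∏ j, h j (y j))) := by
      refine tendsto_integral_of_L1 _ hI0.1 (Eventually.of_forall hIk) ?_
      have h1 := ENNReal.Tendsto.const_mul (a := ENNReal.ofReal (A / (ε / 2) ^ ((m : ℝ) * n - α)))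
        (ENNReal.Tendsto.mul_const
        (b := ∏ j ∈ Finset.univ.erase i, ∫⁻ x, ‖h j x‖ₑ) hlim1
        (Or.inr (ENNReal.prod_ne_top fun j _ => (hint j).2.ne))) (Or.inr ENNReal.ofReal_ne_top)
      rw [zero_mul, mul_zero] at h1
      refine tendsto_of_tendsto_of_tendsto_of_le_of_le tendsto_const_nhds h1 (fun _ => zero_le)
        fun k => ?_
      have h2 := lintegral_mul_prod_le (hupdi _ ((hφi k).sub (hint i)))
        (hbound (⇑(φ k) - h i) ((Function.support_sub _ _).trans (union_subset (hφW k) hsW)))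
      simp_rw [prod_update_sub, mul_sub] at h2
      refine h2.trans_eq ?_
      congr 1
      rw [← Finset.mul_prod_erase _ _ (Finset.mem_univ i), eLpNorm_one_eq_lintegral_enorm]
      congr 1
      · simp
      · exact Finset.prod_congr rfl fun j hj => by simp [(Finset.mem_erase.1 hj).1]
    refine (hconv.comp hns.tendsto_atTop).congr fun k => ?_
    exact (hz2 (ns k) hzS).symm

end Representation

end FracMultilinear

namespace FracMultilinear

/-! ### Geometry of dilated cubes and annuli -/

section Geometry

variable {n m : ℕ}

/-- The product of `m` copies of a cube. -/
def cubeProd (m : ℕ) (c : Rn n) (l : ℝ) : Set (Fin m → Rn n) :=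
  univ.pi fun _ => cube c l

theorem mem_cubeProd {c : Rn n} {l : ℝ} {y : Fin m → Rn n} :
    y ∈ cubeProd m c l ↔ ∀ j, y j ∈ cube c l := by
  simp [cubeProd]

theorem measurableSet_cubeProd (c : Rn n) (l : ℝ) : MeasurableSet (cubeProd m c l) :=
  MeasurableSet.univ_pi fun _ => measurableSet_cube c l

theorem abs_sub_apply_le_dist (z w : Rn n) (i : Fin n) : |z i - w i| ≤ dist z w := by
  rw [dist_eq_norm]
  simpa using PiLp.norm_apply_le (z - w) i

theorem le_dist_of_notMem_cube {c z w : Rn n} {d d' : ℝ} (hz : ∀ i, |z i - c i| ≤ d)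
    (hw : w ∉ cube c d') : d' / 2 - d ≤ dist z w := by
  simp only [cube, mem_ofPred_eq, not_forall, not_le] at hw
  obtain ⟨i, hi⟩ := hw
  have h1 := abs_sub_apply_le_dist z w i
  have h2 := abs_sub_le (w i) (z i) (c i)
  rw [abs_sub_comm (w i) (z i)] at h2
  linarith [hz i]

theorem dist_le_of_coord_le {z w : Rn n} {d : ℝ} (hd : 0 ≤ d) (h : ∀ i, |z i - w i| ≤ d) :
    dist z w ≤ √n * d := by
  rw [EuclideanSpace.dist_eq]
  refine Real.sqrt_le_iff.2 ⟨by positivity, ?_⟩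
  rw [mul_pow, Real.sq_sqrt (Nat.cast_nonneg n)]
  calc ∑ i, dist (z i) (w i) ^ 2 ≤ ∑ _i : Fin n, d ^ 2 := by
        refine Finset.sum_le_sum fun i _ => ?_
        rw [Real.dist_eq]
        gcongr
        exact h i
    _ = _ := by simp

/-- The centre of a cube adjacent to `cube c l`, shifted along the diagonal. -/
noncomputable def diagShift (c : Rn n) (l : ℝ) : Rn n :=
  WithLp.toLp 2 fun i => c i + 2 * l

/-- The shift by `2l` separates the two cubes, so `|z - w|` is comparable to `l` for all `z` and `w`
and the annuli at scale `|z - w|` match dilates of the original cube. The last bound keeps `w` well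
inside the cube of side `13mnl`. -/
theorem coord_bounds_of_mem_diagShift {c z w : Rn n} {l : ℝ} (hz : z ∈ cube c l)
    (hw : w ∈ cube (diagShift c l) l) (i : Fin n) :
    l ≤ |z i - w i| ∧ |z i - w i| ≤ 3 * l ∧ |w i - c i| ≤ 5 / 2 * l := by
  have h1 := abs_le.1 (hz i)
  have h2 := abs_le.1 (hw i)
  simp only [diagShift] at h2
  refine ⟨le_abs.2 (Or.inr (by linarith)), abs_le.2 ⟨by linarith, by linarith⟩,
    abs_le.2 ⟨by linarith, by linarith⟩⟩

/-- The source of the factor 13: from `|z - w| ≤ 3√n l` the cubes centred at `z` have side at most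
`2^k * 12mnl`, and recentring at `c` adds `l ≤ 2^k * mnl`. -/
theorem cubePow_subset_cubeProd (hm : 0 < m) (hn : 0 < n) {c z w : Rn n} {l : ℝ} (hl : 0 < l)
    (hz : z ∈ cube c l) (hw : w ∈ cube (diagShift c l) l) (k : ℕ) :
    cubePow m (k + 2) z ‖z - w‖ ⊆ cubeProd m c (2 ^ k * (13 * (m * n) * l)) := by
  intro y hy
  refine mem_cubeProd.2 fun j i => ?_
  have h1 := hy j i
  have h2 : ‖z - w‖ ≤ √n * (3 * l) := by
    rw [← dist_eq_norm]
    exact dist_le_of_coord_le (by linarith)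
      fun i => (coord_bounds_of_mem_diagShift hz hw i).2.1
  have h3 : √((m : ℝ) * n) * √n ≤ m * n := by
    rw [← Real.sqrt_mul (by positivity)]
    refine Real.sqrt_le_iff.2 ⟨by positivity, ?_⟩
    have : (1 : ℝ) ≤ m := by exact_mod_cast hm
    have hn' : (0 : ℝ) < n := by exact_mod_cast hn
    nlinarith [mul_pos hn' hn', mul_nonneg (mul_pos hn' hn').le (sub_nonneg.2 this)]
  have hmn : (1 : ℝ) ≤ m * n := by exact_mod_cast Nat.mul_pos hm hn
  have h4 := abs_sub_le (y j i) (z i) (c i)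
  have h5 := hz i
  have hk : (1 : ℝ) ≤ 2 ^ k := one_le_pow₀ (by norm_num)
  have h6 : √((m : ℝ) * n) * ‖z - w‖ ≤ m * n * (3 * l) := by
    calc _ ≤ √((m : ℝ) * n) * (√n * (3 * l)) := by gcongr
      _ = (√((m : ℝ) * n) * √n) * (3 * l) := by ring
      _ ≤ _ := by gcongr
  have h7 : (2 : ℝ) ^ (k + 2) * √((m : ℝ) * n) * ‖z - w‖ ≤ 2 ^ k * (12 * (m * n) * l) := by
    calc _ = 4 * 2 ^ k * (√((m : ℝ) * n) * ‖z - w‖) := by ring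
      _ ≤ 4 * 2 ^ k * (m * n * (3 * l)) := by gcongr
      _ = _ := by ring
  have h8 : l ≤ 2 ^ k * (m * n * l) := by
    calc l = 1 * (1 * l) := by ring
      _ ≤ _ := by gcongr
  nlinarith

theorem exists_mem_annulus (hm : 0 < m) (hn : 0 < n) {z : Rn n} {ρ : ℝ} (hρ : 0 < ρ)
    {y : Fin m → Rn n} (hy : y ∉ cubePow m 2 z ρ) :
    ∃ k : ℕ, y ∈ cubePow m (k + 3) z ρ \ cubePow m (k + 2) z ρ := by
  classical
  have ha : 0 < √((m : ℝ) * n) * ρ := by positivity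
  have hex : ∃ i : ℕ, y ∈ cubePow m (i + 2) z ρ := by
    obtain ⟨i, hi⟩ := pow_unbounded_of_one_lt (2 * (∑ j, dist (y j) z) / (√((m : ℝ) * n) * ρ))
      one_lt_two
    refine ⟨i, fun j i' => (abs_sub_apply_le_dist _ _ i').trans ?_⟩
    rw [div_lt_iff₀ ha] at hi
    have h1 : dist (y j) z ≤ ∑ j, dist (y j) z :=
      Finset.single_le_sum (f := fun j => dist (y j) z) (fun _ _ => dist_nonneg) (Finset.mem_univ j)
    have h2 : (2 : ℝ) ^ (i + 2) * √((m : ℝ) * n) * ρ = 4 * (2 ^ i * (√((m : ℝ) * n) * ρ)) := by ring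
    have h3 : 0 < (2 : ℝ) ^ i * (√((m : ℝ) * n) * ρ) := by positivity
    rw [h2]
    linarith
  obtain hk | ⟨j, hj⟩ : Nat.find hex = 0 ∨ ∃ j, Nat.find hex = j + 1 := by
    cases Nat.find hex <;> simp
  · have := Nat.find_spec hex
    rw [hk] at this
    exact absurd this hy
  · refine ⟨j, ?_, Nat.find_min hex (by omega)⟩
    have := Nat.find_spec hex
    rwa [hj] at this

end Geometry

/-! ### The operator off the product of dilated cubes -/

section Difference

variable {n m : ℕ} {𝕜 : Type*} [RCLike 𝕜]

theorem prod_indicator_cubeProd (g : Fin m → Rn n → 𝕜) (c : Rn n) (l : ℝ) (y : Fin m → Rn n) :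
    ∏ j, (cube c l).indicator (g j) (y j) =
      (cubeProd m c l).indicator (fun y => ∏ j, g j (y j)) y := by
  by_cases hy : y ∈ cubeProd m c l
  · rw [indicator_of_mem hy]
    exact Finset.prod_congr rfl fun j _ => indicator_of_mem (mem_cubeProd.1 hy j) _
  · rw [indicator_of_notMem hy]
    obtain ⟨j, hj⟩ := not_forall.1 fun h => hy (mem_cubeProd.2 h)
    exact Finset.prod_eq_zero (Finset.mem_univ j) (indicator_of_notMem hj _)

/-- The sum over all subsets is the full product, and the term of the full subset is its restriction
to `(cube c l)^m`; removing that term leaves the complement of the product set. -/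
theorem sum_prod_piecewise_indicator (g : Fin m → Rn n → 𝕜) (c : Rn n) (l : ℝ)
    (y : Fin m → Rn n) :
    ∑ J ∈ (Finset.univ : Finset (Finset (Fin m))).erase Finset.univ,
        ∏ j, J.piecewise (fun j => (cube c l).indicator (g j))
          (fun j => (cube c l)ᶜ.indicator (g j)) j (y j) =
      (cubeProd m c l)ᶜ.indicator (fun y => ∏ j, g j (y j)) y := by
  have h1 := (MultilinearMap.mkPiAlgebra 𝕜 (Fin m) 𝕜).map_add_univ
    (fun j => (cube c l).indicator (g j) (y j)) (fun j => (cube c l)ᶜ.indicator (g j) (y j))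
  simp only [MultilinearMap.mkPiAlgebra_apply, Pi.add_apply] at h1
  rw [← Finset.add_sum_erase _ _ (Finset.mem_univ Finset.univ)] at h1
  have e : ∀ j, (cube c l).indicator (g j) (y j) + (cube c l)ᶜ.indicator (g j) (y j) =
      g j (y j) := fun j => indicator_self_add_compl_apply _ _ _
  have e2 : ∀ J : Finset (Fin m), (∏ j, J.piecewise (fun j => (cube c l).indicator (g j))
      (fun j => (cube c l)ᶜ.indicator (g j)) j (y j)) =
      ∏ j, J.piecewise (fun j => (cube c l).indicator (g j) (y j))
        (fun j => (cube c l)ᶜ.indicator (g j) (y j)) j := by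
    intro J
    refine Finset.prod_congr rfl fun j _ => ?_
    by_cases hj : j ∈ J <;> simp [hj]
  simp_rw [e2]
  simp_rw [e] at h1
  rw [Finset.piecewise_univ, prod_indicator_cubeProd] at h1
  have h2 := indicator_self_add_compl_apply (cubeProd m c l) (fun y => ∏ j, g j (y j)) y
  rw [h1] at h2
  exact (add_left_cancel h2).symm

theorem hasCompactSupport_indicator {g : Rn n → 𝕜} (hg : HasCompactSupport g) (S : Set (Rn n)) :
    HasCompactSupport (S.indicator g) :=
  hg.mono fun y hy => by
    by_contra h
    rw [Function.notMem_support] at h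
    exact hy (by simp [indicator, h])

theorem notMem_cube_of_prod_indicator_ne_zero {g : Fin m → Rn n → 𝕜} {c : Rn n} {l : ℝ}
    {J : Finset (Fin m)} {j : Fin m} (hj : j ∉ J) {y : Fin m → Rn n}
    (hy : ∀ j, J.piecewise (fun j => (cube c l).indicator (g j))
      (fun j => (cube c l)ᶜ.indicator (g j)) j (y j) ≠ 0) : y j ∉ cube c l := by
  have h := hy j
  rw [Finset.piecewise_eq_of_notMem _ _ _ hj] at h
  exact fun h' => h (indicator_of_notMem (by simpa using h') _)

/-- Off the product of dilated cubes the operator is given by the kernel. -/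
theorem applyFun_sub_applyFun_indicator {s : Fin m → ℝ} {T : LpMultilinear n m 𝕜 s}
    {K : Rn n → (Fin m → Rn n) → 𝕜} {α q : ℝ}
    (hn : 0 < n) (hm : 0 < m) (hs : ∀ j, 1 ≤ s j) (hα : α ≤ (m : ℝ) * n)
    (hq : 0 < q) (hK : IsFracKernel α K) (hTK : HasKernel T K) (hT : WeakBounded T q)
    {g : Fin m → Rn n → 𝕜}
    (hg : ∀ j, MemLp (g j) (ENNReal.ofReal (s j)) (volume : Measure (Rn n)))
    (hgc : ∀ j, HasCompactSupport (g j)) (c : Rn n) {l l' : ℝ} (hll : l < l') :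
    ∀ᵐ z ∂(volume : Measure (Rn n)), z ∈ cube c l →
      applyFun T g z - applyFun T (fun j => (cube c l').indicator (g j)) z =
        ∫ y in (cubeProd m c l')ᶜ, K z y * ∏ j, g j (y j) := by
  set g0 : Fin m → Rn n → 𝕜 := fun j => (cube c l').indicator (g j) with hg0
  set g1 : Fin m → Rn n → 𝕜 := fun j => (cube c l')ᶜ.indicator (g j) with hg1
  have hm0 : ∀ j, MemLp (g0 j) (ENNReal.ofReal (s j)) (volume : Measure (Rn n)) := fun j =>
    (hg j).indicator (measurableSet_cube c l')
  have hm1 : ∀ j, MemLp (g1 j) (ENNReal.ofReal (s j)) (volume : Measure (Rn n)) := fun j =>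
    (hg j).indicator (measurableSet_cube c l').compl
  have hadd : g0 + g1 = g := by
    ext j y
    exact indicator_self_add_compl_apply _ _ _
  have hpm : ∀ (J : Finset (Fin m)) (j : Fin m),
      MemLp (J.piecewise g0 g1 j) (ENNReal.ofReal (s j)) (volume : Measure (Rn n)) := by
    intro J j
    by_cases hj : j ∈ J
    · simpa [hj] using hm0 j
    · simpa [hj] using hm1 j
  have hpc : ∀ (J : Finset (Fin m)) (j : Fin m), HasCompactSupport (J.piecewise g0 g1 j) := by
    intro J j
    by_cases hj : j ∈ J
    · simpa [hj] using hasCompactSupport_indicator (hgc j) (cube c l')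
    · simpa [hj] using hasCompactSupport_indicator (hgc j) (cube c l')ᶜ
  have hd : 0 < l' / 2 - l / 2 := by linarith
  -- A subset `J ≠ univ` leaves an entry `j₀` vanishing on the larger cube, hence supported at
  -- distance at least `(l' - l) / 2` from the smaller one.
  have hrep : ∀ J : Finset (Fin m), ∀ᵐ z ∂(volume : Measure (Rn n)), J ≠ Finset.univ →
      z ∈ cube c l → applyFun T (J.piecewise g0 g1) z =
        ∫ y : Fin m → Rn n, K z y * ∏ j, J.piecewise g0 g1 j (y j) := by
    intro J
    by_cases hJ : J = Finset.univ
    · exact Eventually.of_forall fun z h => absurd hJ h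
    obtain ⟨j₀, hj₀⟩ : ∃ j, j ∉ J := by
      by_contra! h
      exact hJ (Finset.eq_univ_iff_forall.2 h)
    have h1 := applyFun_eq_integral (S := cube c l) (j₀ := j₀) hn hs hα hq hK hTK hT Finset.univ
      (l' / 2 - l / 2) hd (J.piecewise g0 g1) (hpm J) (hpc J)
      (fun j hj => absurd (Finset.mem_univ j) hj) ?_
    · filter_upwards [h1] with z hz _ using hz
    · intro z hz w hw
      have hcl : IsClosed {w : Rn n | l' / 2 - l / 2 ≤ dist z w} :=
        isClosed_le continuous_const (by fun_prop)
      refine closure_minimal (fun w' hw' => ?_) hcl hw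
      rw [Finset.piecewise_eq_of_notMem _ _ _ hj₀] at hw'
      refine le_dist_of_notMem_cube hz fun h' => hw' ?_
      exact indicator_of_notMem (by simpa using h') _
  obtain ⟨A, hA0, hA⟩ := hK.size
  have he : 0 ≤ (m : ℝ) * n - α := by linarith
  have hsum := applyFun_add_eq_sum T hm0 hm1
  rw [hadd] at hsum
  filter_upwards [hsum, ae_all_iff.2 hrep, hK.ae_aestronglyMeasurable hn hm] with z hz1 hz2 hz3 hzQ
  rw [hz1, ← Finset.add_sum_erase _ _ (Finset.mem_univ Finset.univ), Finset.piecewise_univ,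
    add_sub_cancel_left, Finset.sum_congr rfl fun J hJ => hz2 J (Finset.ne_of_mem_erase hJ) hzQ,
    ← integral_finsetSum, ← integral_indicator (measurableSet_cubeProd c l').compl]
  · refine integral_congr_ae (Eventually.of_forall fun y => ?_)
    simp only
    rw [← Finset.mul_sum, sum_prod_piecewise_indicator, ← indicator_mul_right]
  · intro J hJ
    obtain ⟨j₀, hj₀⟩ : ∃ j, j ∉ J := by
      by_contra! h
      exact Finset.ne_of_mem_erase hJ (Finset.eq_univ_iff_forall.2 h)
    refine integrable_mul_prod hz3 (fun j =>
      integrable_of_memLp_of_hasCompactSupport (hs j) (hpm J j) (hpc J j))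
      (A := A / (l' / 2 - l / 2) ^ ((m : ℝ) * n - α)) fun y hy => ?_
    exact norm_kernel_le hA0 he hA (j := j₀) hd
      (le_dist_of_notMem_cube hzQ (notMem_cube_of_prod_indicator_ne_zero hj₀ hy))

/-- The parameter `d` allows for points outside the base cube, such as the comparison point `w` in
the shifted cube. -/
theorem integrableOn_kernel_mul_prod {K : Rn n → (Fin m → Rn n) → 𝕜} {α : ℝ}
    (hα : α ≤ (m : ℝ) * n) (hK : IsFracKernel α K) {z c : Rn n}
    (hKz : AEStronglyMeasurable (K z) volume) {d l : ℝ} (hdl : d < l / 2)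
    (hz : ∀ i, |z i - c i| ≤ d) {g : Fin m → Rn n → 𝕜} (hg : ∀ j, Integrable (g j) volume) :
    IntegrableOn (fun y => K z y * ∏ j, g j (y j)) (cubeProd m c l)ᶜ volume := by
  obtain ⟨A, hA0, hA⟩ := hK.size
  have hms := (measurableSet_cubeProd (m := m) c l).compl
  rw [← integrable_indicator_iff hms]
  have h1 := integrable_mul_prod (hKz.indicator hms) hg
    (A := A / (l / 2 - d) ^ ((m : ℝ) * n - α)) fun y _ => ?_
  · refine h1.congr (Eventually.of_forall fun y => ?_)
    exact (indicator_mul_left (cubeProd m c l)ᶜ (K z) fun y => ∏ j, g j (y j)).symm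
  · by_cases hy : y ∈ cubeProd m c l
    · rw [indicator_of_notMem (by simpa using hy), norm_zero]
      have : 0 < l / 2 - d := by linarith
      positivity
    · rw [indicator_of_mem (by simpa using hy)]
      obtain ⟨j, hj⟩ := not_forall.1 fun h => hy (mem_cubeProd.2 h)
      exact norm_kernel_le hA0 (by linarith) hA (j := j) (by linarith)
        (le_dist_of_notMem_cube hz hj)

end Difference

end FracMultilinear

namespace FracMultilinear

/-! ### Summing the smoothness condition over annuli -/

section Annuli

variable {n m : ℕ} {𝕜 : Type*} [RCLike 𝕜]

theorem lintegral_cubeProd_prod_rpow {g : Fin m → Rn n → 𝕜} {p : ℝ} (hp : 0 < p)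
    (hg : ∀ j, MemLp (g j) (ENNReal.ofReal p) (volume : Measure (Rn n))) (c : Rn n) {l : ℝ}
    (hl : 0 < l) :
    (∫⁻ y in cubeProd m c l, (∏ j, ‖g j (y j)‖ₑ) ^ p) ^ (1 / p) =
      volume (cube c l) ^ ((m : ℝ) / p) *
        ∏ j, (∫⁻ x, ‖g j x‖ₑ ^ p ∂(cubeProb c l)) ^ (1 / p) := by
  have hint : ∀ j, Integrable (fun x => ‖g j x‖ ^ p) (volume.restrict (cube c l)) := fun j => by
    have h := (hg j).integrable_norm_rpow (by simpa using hp) ENNReal.ofReal_ne_top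
    rw [ENNReal.toReal_ofReal hp.le] at h
    exact h.restrict
  have e : ∀ j x, ‖‖g j x‖ ^ p‖ₑ = ‖g j x‖ₑ ^ p := fun j x => by
    rw [Real.enorm_rpow_of_nonneg (norm_nonneg _) hp.le, enorm_norm]
  have h1 := lintegral_prod_enorm_eq hint
  simp_rw [e] at h1
  rw [cubeProd, volume_pi, Measure.restrict_pi_pi]
  simp_rw [← ENNReal.prod_rpow_of_nonneg hp.le]
  rw [h1]
  simp_rw [setLIntegral_cube_eq c hl]
  rw [Finset.prod_mul_distrib, ENNReal.mul_rpow_of_nonneg _ _ (by positivity),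
    ENNReal.prod_rpow_of_nonneg (by positivity)]
  congr 1
  rw [Finset.prod_const, Finset.card_univ, Fintype.card_fin, ← ENNReal.rpow_natCast,
    ← ENNReal.rpow_mul]
  congr 1
  ring

/-- Homogeneity: put `e = α - mn/p`. As `e ≤ 0`, `ρ` may be lowered to `l`; then `(2^k l)^e` is the
side length to the power `e` up to `L^{-e}`, and multiplying by the side length to the power `mn/p`
leaves the power `α`. -/
theorem annulus_weight_le {α p C A ρ l L : ℝ} {k : ℕ} (hA : 0 < A) (hC : 0 ≤ C) (hl : 0 < l)
    (hL : 0 < L) (hρ : l ≤ ρ) (he : α - (m : ℝ) * n / p ≤ 0) (hn : 0 < n) (c : Rn n) :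
    ENNReal.ofReal (A * C * (2 : ℝ) ^ ((k : ℝ) * (α - (m : ℝ) * n / p)) *
        ρ ^ (α - (m : ℝ) * n / p)) * volume (cube c (2 ^ k * (L * l))) ^ ((m : ℝ) / p) ≤
      ENNReal.ofReal (A * L ^ ((m : ℝ) * n / p - α)) * ENNReal.ofReal C *
        volume (cube c (2 ^ k * (L * l))) ^ (α / n) := by
  have hn' : (0 : ℝ) < n := by exact_mod_cast hn
  have hside : 0 < 2 ^ k * (L * l) := by positivity
  have hρ0 : 0 < ρ := hl.trans_le hρ
  set e := α - (m : ℝ) * n / p with he'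
  rw [volume_cube c hside, ENNReal.ofReal_rpow_of_pos (by positivity),
    ENNReal.ofReal_rpow_of_pos (by positivity), ← ENNReal.ofReal_mul (by positivity),
    ← ENNReal.ofReal_mul (by positivity), ← ENNReal.ofReal_mul (by positivity)]
  refine ENNReal.ofReal_le_ofReal ?_
  have h1 : ρ ^ e ≤ l ^ e := Real.rpow_le_rpow_of_nonpos hl hρ he
  have h2 : (2 : ℝ) ^ ((k : ℝ) * e) * l ^ e =
      (2 ^ k * (L * l)) ^ e * L ^ ((m : ℝ) * n / p - α) := by
    have h3 : ((m : ℝ) * n / p - α) = -e := by rw [he']; ring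
    rw [h3, Real.mul_rpow (by positivity) (by positivity), Real.mul_rpow hL.le hl.le,
      Real.rpow_mul zero_le_two, Real.rpow_natCast, mul_assoc, mul_right_comm (L ^ e),
      ← Real.rpow_add hL, add_neg_cancel, Real.rpow_zero, one_mul]
  have h4 : (2 ^ k * (L * l)) ^ e * ((2 ^ k * (L * l)) ^ n) ^ ((m : ℝ) / p) =
      ((2 ^ k * (L * l)) ^ n) ^ (α / n) := by
    rw [← Real.rpow_natCast (2 ^ k * (L * l)) n, ← Real.rpow_mul hside.le,
      ← Real.rpow_mul hside.le, ← Real.rpow_add hside]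
    congr 1
    rw [he', mul_div_cancel₀ α hn'.ne']
    ring
  calc A * C * (2 : ℝ) ^ ((k : ℝ) * e) * ρ ^ e * ((2 ^ k * (L * l)) ^ n) ^ ((m : ℝ) / p)
      ≤ A * C * (2 : ℝ) ^ ((k : ℝ) * e) * l ^ e * ((2 ^ k * (L * l)) ^ n) ^ ((m : ℝ) / p) := by
        gcongr
    _ = A * C * ((2 : ℝ) ^ ((k : ℝ) * e) * l ^ e) * ((2 ^ k * (L * l)) ^ n) ^ ((m : ℝ) / p) := by
        ring
    _ = A * L ^ ((m : ℝ) * n / p - α) * C *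
          ((2 ^ k * (L * l)) ^ e * ((2 ^ k * (L * l)) ^ n) ^ ((m : ℝ) / p)) := by
        rw [h2]; ring
    _ = _ := by rw [h4]

/-- The smoothness condition bounds the oscillation of the part of the operator away from the
diagonal by a sum over dilated cubes. -/
theorem lintegral_kernel_sub_le {α p₀ p₀' A : ℝ} {Ck : ℕ → ℝ} {K : Rn n → (Fin m → Rn n) → 𝕜}
    (hm : 0 < m) (hn : 0 < n) (hp : 1 < p₀) (hpp : 1 / p₀ + 1 / p₀' = 1)
    (he : α - (m : ℝ) * n / p₀' ≤ 0) (hCk : ∀ k, 1 ≤ k → 0 < Ck k) (hA : 0 < A)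
    (hsm : ∀ k : ℕ, 1 ≤ k → ∀ x x' : Rn n, x ≠ x' →
      (∫⁻ y in cubePow m (k + 2) x ‖x - x'‖ \ cubePow m (k + 1) x ‖x - x'‖,
          ‖K x y - K x' y‖ₑ ^ p₀) ^ (1 / p₀) ≤
        ENNReal.ofReal (A * Ck k * (2 : ℝ) ^ ((k : ℝ) * (α - (m : ℝ) * n / p₀')) *
          ‖x - x'‖ ^ (α - (m : ℝ) * n / p₀')))
    {g : Fin m → Rn n → 𝕜}
    (hg : ∀ j, MemLp (g j) (ENNReal.ofReal p₀') (volume : Measure (Rn n)))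
    {c z w : Rn n} {l : ℝ} (hl : 0 < l) (hz : z ∈ cube c l) (hw : w ∈ cube (diagShift c l) l)
    (hKz : AEStronglyMeasurable (K z) volume) (hKw : AEStronglyMeasurable (K w) volume) :
    ∫⁻ y in (cubeProd m c (13 * (m * n) * l))ᶜ, ‖K z y - K w y‖ₑ * ∏ j, ‖g j (y j)‖ₑ ≤
      ENNReal.ofReal (A * (13 * (m * n)) ^ ((m : ℝ) * n / p₀' - α)) *
        ∑' k : ℕ, ENNReal.ofReal (Ck (k + 1)) *
          (volume (cube c (2 ^ (k + 1) * (13 * (m * n) * l))) ^ (α / n) *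
          ∏ j, (∫⁻ x, ‖g j x‖ₑ ^ p₀'
            ∂(cubeProb c (2 ^ (k + 1) * (13 * (m * n) * l)))) ^ (1 / p₀')) := by
  have hconj : p₀.HolderConjugate p₀' := by
    rw [Real.holderConjugate_iff]
    exact ⟨hp, by simpa [one_div] using hpp⟩
  have hp' : 0 < p₀' := hconj.symm.pos
  have hL : (0 : ℝ) < 13 * (m * n) := by positivity
  have hi : Fin n := ⟨0, hn⟩
  have hρl : l ≤ ‖z - w‖ := by
    have h1 := (coord_bounds_of_mem_diagShift hz hw hi).1
    rw [← dist_eq_norm]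
    exact h1.trans (abs_sub_apply_le_dist z w hi)
  have hρ : 0 < ‖z - w‖ := hl.trans_le hρl
  have hne : z ≠ w := by
    rintro rfl
    simp at hρ
  -- The innermost `cubePow m 2` lies inside the excluded product, so only annuli with smoothness
  -- index `k + 1 ≥ 1` are needed.
  have hcover : (cubeProd m c (13 * (m * n) * l))ᶜ ⊆
      ⋃ k : ℕ, (cubePow m (k + 3) z ‖z - w‖ \ cubePow m (k + 2) z ‖z - w‖) := by
    intro y hy
    refine mem_iUnion.2 (exists_mem_annulus hm hn hρ fun h => hy ?_)
    have h1 := cubePow_subset_cubeProd hm hn hl hz hw 0 h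
    rwa [pow_zero, one_mul] at h1
  have hgm : AEMeasurable (fun y : Fin m → Rn n => ∏ j, ‖g j (y j)‖ₑ) volume := by
    refine Finset.aemeasurable_fun_prod _ fun j _ => ?_
    exact ((hg j).1.comp_quasiMeasurePreserving (Measure.quasiMeasurePreserving_eval _ j)).enorm
  have hKm : AEMeasurable (fun y => ‖K z y - K w y‖ₑ) volume := (hKz.sub hKw).enorm
  calc _ ≤ ∫⁻ y in ⋃ k : ℕ, (cubePow m (k + 3) z ‖z - w‖ \ cubePow m (k + 2) z ‖z - w‖),
        ‖K z y - K w y‖ₑ * ∏ j, ‖g j (y j)‖ₑ := lintegral_mono_set hcover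
    _ ≤ ∑' k : ℕ, ∫⁻ y in (cubePow m (k + 3) z ‖z - w‖ \ cubePow m (k + 2) z ‖z - w‖),
        ‖K z y - K w y‖ₑ * ∏ j, ‖g j (y j)‖ₑ := lintegral_iUnion_le _ _
    _ ≤ _ := by
      rw [← ENNReal.tsum_mul_left]
      refine ENNReal.tsum_le_tsum fun k => ?_
      have hside : 0 < 2 ^ (k + 1) * (13 * (m * n) * l) := by positivity
      refine (ENNReal.lintegral_mul_le_Lp_mul_Lq _ hconj hKm.restrict hgm.restrict).trans ?_
      have h1 := hsm (k + 1) (by omega) z w hne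
      have h2 : (∫⁻ y in (cubePow m (k + 3) z ‖z - w‖ \ cubePow m (k + 2) z ‖z - w‖),
          (∏ j, ‖g j (y j)‖ₑ) ^ p₀') ^ (1 / p₀') ≤ _ :=
        (ENNReal.rpow_le_rpow (lintegral_mono_set (sdiff_subset.trans
          (cubePow_subset_cubeProd hm hn hl hz hw (k + 1)))) (by positivity)).trans_eq
          (lintegral_cubeProd_prod_rpow hp' hg c hside)
      refine (mul_le_mul' h1 h2).trans ?_
      refine (mul_assoc _ _ _).symm.le.trans ?_
      refine (mul_le_mul' (annulus_weight_le hA (hCk _ (by omega)).le hl hL hρl he hn c)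
        le_rfl).trans_eq ?_
      ring

end Annuli

end FracMultilinear

namespace FracMultilinear

/-! ### Hölder's inequality and monotonicity of power means -/

section Holder

theorem lintegral_enorm_mul_rpow_le {X 𝕜 : Type*} [MeasurableSpace X] [RCLike 𝕜] {μ : Measure X}
    {p t : ℝ} (hp : 0 < p) (hpt : p < t) {u v : X → 𝕜} (hu : AEStronglyMeasurable u μ)
    (hv : AEStronglyMeasurable v μ) :
    (∫⁻ y, ‖u y * v y‖ₑ ^ p ∂μ) ^ (1 / p) ≤
      (∫⁻ y, ‖u y‖ₑ ^ (p * t / (t - p)) ∂μ) ^ (1 / (p * t / (t - p))) *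
        (∫⁻ y, ‖v y‖ₑ ^ t ∂μ) ^ (1 / t) := by
  have ht : 0 < t := hp.trans hpt
  have hd : 0 < t - p := sub_pos.2 hpt
  have h1 : p < p * t / (t - p) := by
    rw [lt_div_iff₀ hd]
    nlinarith
  have h2 : 1 / p = 1 / (p * t / (t - p)) + 1 / t := by
    field_simp
    ring
  have h := ENNReal.lintegral_Lp_mul_le_Lq_mul_Lr hp h1 h2 μ hu.enorm hv.enorm
  simpa only [Pi.mul_apply, enorm_mul] using h

theorem lintegral_enorm_rpow_mono {X 𝕜 : Type*} [MeasurableSpace X] [RCLike 𝕜] {μ : Measure X}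
    [IsProbabilityMeasure μ] {p t : ℝ} (hp : 0 < p) (hpt : p ≤ t) {v : X → 𝕜}
    (hv : AEStronglyMeasurable v μ) :
    (∫⁻ y, ‖v y‖ₑ ^ p ∂μ) ^ (1 / p) ≤ (∫⁻ y, ‖v y‖ₑ ^ t ∂μ) ^ (1 / t) := by
  simpa only [eLpNorm'_eq_lintegral_enorm] using eLpNorm'_le_eLpNorm'_of_exponent_le hp hpt μ hv

end Holder

/-! ### Tuples with an oscillation factor, and the near-diagonal estimate -/

section Estimates

variable {n m : ℕ} {𝕜 : Type*} [RCLike 𝕜]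

theorem exists_cube_superset {f : Rn n → 𝕜} (hf : HasCompactSupport f) :
    ∃ l : ℝ, 0 < l ∧ Function.support f ⊆ cube 0 l := by
  obtain ⟨M, hM⟩ := hf.isBounded.exists_norm_le
  refine ⟨2 * |M| + 1, by positivity, fun y hy i => ?_⟩
  have h1 := abs_sub_apply_le_dist y 0 i
  rw [dist_zero_right] at h1
  have h2 := hM y (subset_tsupport f hy)
  linarith [le_abs_self M]

/-- By John–Nirenberg, `b` lies in `L^p` on a cube containing the support of `f`. Thus the tuples in
the commutator belong to the domain of the operator, and `applyFun` never takes its default value 0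
on them. -/
theorem MemBMO.memLp_sub_const_mul {b : Rn n → 𝕜} (hb : MemBMO b) (κ : 𝕜) {f : Rn n → 𝕜}
    (hf : Measurable f) {M : ℝ} (hM : ∀ y, ‖f y‖ ≤ M) (hc : HasCompactSupport f) {p : ℝ}
    (hp : 1 ≤ p) : MemLp (fun y => (b y - κ) * f y) (ENNReal.ofReal p) volume := by
  have hp0 : 0 < p := by linarith
  obtain ⟨l, hl, hsub⟩ := exists_cube_superset hc
  obtain ⟨C, hC, H⟩ := john_nirenberg_cube n 𝕜 hp0
  have hfin := isFiniteMeasure_restrict.2 (volume_cube_ne_top (0 : Rn n) hl)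
  have hbm : AEStronglyMeasurable b (volume.restrict (cube (0 : Rn n) l)) :=
    hb.1.aestronglyMeasurable.restrict
  have h1 : MemLp (fun y => b y - ⨍ z in cube 0 l, b z) (ENNReal.ofReal p)
      (volume.restrict (cube (0 : Rn n) l)) := by
    refine ⟨hbm.sub aestronglyMeasurable_const, ?_⟩
    rw [eLpNorm_eq_lintegral_rpow_enorm_toReal (by simpa using hp0) ENNReal.ofReal_ne_top,
      ENNReal.toReal_ofReal hp0.le, setLIntegral_cube_eq _ hl,
      ENNReal.mul_rpow_of_nonneg _ _ (by positivity)]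
    refine ENNReal.mul_lt_top
      (ENNReal.rpow_lt_top_of_nonneg (by positivity) (volume_cube_ne_top _ hl)) ?_
    exact (H b hb 0 l hl).trans_lt (ENNReal.mul_lt_top hC.lt_top hb.2)
  have h2 : MemLp (fun y => b y - κ) (ENNReal.ofReal p) (volume.restrict (cube (0 : Rn n) l)) := by
    refine (h1.add (memLp_const ((⨍ z in cube 0 l, b z) - κ))).ae_eq
      (Eventually.of_forall fun y => ?_)
    simp
  have h3 : MemLp (fun y => (b y - κ) * f y) (ENNReal.ofReal p)
      (volume.restrict (cube (0 : Rn n) l)) := by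
    refine h2.of_le_mul (c := M) (h2.1.mul hf.aestronglyMeasurable)
      (Eventually.of_forall fun y => ?_)
    rw [norm_mul, mul_comm]
    gcongr
    exact hM y
  rw [← memLp_indicator_iff_restrict (measurableSet_cube _ _)] at h3
  refine h3.ae_eq (Eventually.of_forall fun y => ?_)
  by_cases hy : y ∈ cube 0 l
  · rw [indicator_of_mem hy]
  · simp [indicator_of_notMem hy, Function.notMem_support.1 fun h => hy (hsub h)]

theorem memLp_of_bounded_of_hasCompactSupport {f : Rn n → 𝕜}
    (hf : Measurable f) {M : ℝ} (hM : ∀ y, ‖f y‖ ≤ M) (hc : HasCompactSupport f) (p : ℝ) :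
    MemLp f (ENNReal.ofReal p) volume :=
  hc.memLp_of_bound hf.aestronglyMeasurable M (Eventually.of_forall hM)

theorem le_multiFracMaximal (α r : ℝ) (f : Fin m → Rn n → 𝕜) {c x : Rn n} {l : ℝ} (hl : 0 < l)
    (hx : x ∈ cube c l) :
    volume (cube c l) ^ (α / n) * ∏ j, (∫⁻ y, ‖f j y‖ₑ ^ r ∂(cubeProb c l)) ^ (1 / r) ≤
      multiFracMaximal α r f x := by
  simp_rw [← laverage_cube]
  exact le_iSup_of_le c (le_iSup_of_le l (le_iSup_of_le hl (le_iSup_of_le hx le_rfl)))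

theorem le_powMaximal {δ : ℝ} (hδ : 0 < δ) (f : Rn n → 𝕜) {c x : Rn n} {l : ℝ} (hl : 0 < l)
    (hx : x ∈ cube c l) :
    (∫⁻ y, ‖f y‖ₑ ^ δ ∂(cubeProb c l)) ^ (1 / δ) ≤ powMaximal δ f x := by
  rw [← laverage_cube, powMaximal]
  gcongr
  exact le_iSup_of_le c (le_iSup_of_le l (le_iSup_of_le hl (le_iSup_of_le hx le_rfl)))

/-- The tuple in which the `i`-th entry of `f` is multiplied by `b - κ`. -/
def mulEntry (f : Fin m → Rn n → 𝕜) (i : Fin m) (b : Rn n → 𝕜) (κ : 𝕜) : Fin m → Rn n → 𝕜 :=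
  Function.update f i fun y => (b y - κ) * f i y

/-- Averages over dilated cubes of a tuple with one entry multiplied by the oscillation of a `BMO`
function are controlled by the multilinear fractional maximal function. -/
theorem prod_mulEntry_le (n : ℕ) (𝕜 : Type*) [RCLike 𝕜] (α : ℝ) {s : Fin m → ℝ} {t : ℝ}
    (hs : ∀ j, 1 ≤ s j) (ht : ∀ j, s j < t) :
    ∃ C : ℝ≥0∞, C ≠ ∞ ∧ ∀ b : Rn n → 𝕜, MemBMO b → ∀ f : Fin m → Rn n → 𝕜,
      (∀ j, AEStronglyMeasurable (f j) volume) → ∀ (i : Fin m) (c : Rn n) (l : ℝ), 0 < l →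
      ∀ (k : ℕ) (x : Rn n), x ∈ cube c (2 ^ k * l) →
      volume (cube c (2 ^ k * l)) ^ (α / n) *
        ∏ j, (∫⁻ y, ‖mulEntry f i b (⨍ z in cube c l, b z) j y‖ₑ ^ s j
          ∂(cubeProb c (2 ^ k * l))) ^ (1 / s j) ≤
        C * (k + 1) * bmoNorm b * multiFracMaximal α t f x := by
  -- The Hölder partner of `t`: `1 / s i = 1 / r + 1 / t`. It must be at least one for Minkowski's
  -- inequality in `bmo_oscillation_dilate`.
  have hr : ∀ i, 1 ≤ s i * t / (t - s i) := by
    intro i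
    rw [le_div_iff₀ (sub_pos.2 (ht i))]
    nlinarith [hs i, ht i]
  choose C hC H using fun i => bmo_oscillation_dilate n 𝕜 (hr i)
  refine ⟨∑ i, C i, ENNReal.sum_ne_top.2 fun i _ => hC i, ?_⟩
  intro b hb f hf i c l hl k x hx
  have hside : 0 < 2 ^ k * l := by positivity
  have := isProbabilityMeasure_cubeProb c hside
  have hac := cubeProb_absolutelyContinuous c (2 ^ k * l)
  set κ := ⨍ z in cube c l, b z with hκ
  have hi : (∫⁻ y, ‖mulEntry f i b κ i y‖ₑ ^ s i ∂(cubeProb c (2 ^ k * l))) ^ (1 / s i) ≤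
      (∑ i, C i) * (k + 1) * bmoNorm b *
        (∫⁻ y, ‖f i y‖ₑ ^ t ∂(cubeProb c (2 ^ k * l))) ^ (1 / t) := by
    rw [mulEntry, Function.update_self]
    refine (lintegral_enorm_mul_rpow_le (by linarith [hs i]) (ht i)
      ((hb.1.aestronglyMeasurable.mono_ac hac).sub aestronglyMeasurable_const)
      ((hf i).mono_ac hac)).trans ?_
    gcongr
    refine (H i b hb c l hl k).trans ?_
    gcongr
    exact Finset.single_le_sum (f := C) (fun _ _ => zero_le) (Finset.mem_univ i)
  have hj : ∀ j ∈ Finset.univ.erase i,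
      (∫⁻ y, ‖mulEntry f i b κ j y‖ₑ ^ s j ∂(cubeProb c (2 ^ k * l))) ^ (1 / s j) ≤
        (∫⁻ y, ‖f j y‖ₑ ^ t ∂(cubeProb c (2 ^ k * l))) ^ (1 / t) := by
    intro j hji
    rw [mulEntry, Function.update_of_ne (Finset.ne_of_mem_erase hji)]
    exact lintegral_enorm_rpow_mono (by linarith [hs j]) (ht j).le ((hf j).mono_ac hac)
  calc _ ≤ volume (cube c (2 ^ k * l)) ^ (α / n) * ((∑ i, C i) * (k + 1) * bmoNorm b *
        ∏ j, (∫⁻ y, ‖f j y‖ₑ ^ t ∂(cubeProb c (2 ^ k * l))) ^ (1 / t)) := by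
        gcongr
        rw [← Finset.mul_prod_erase _ _ (Finset.mem_univ i),
          ← Finset.mul_prod_erase Finset.univ (fun j =>
            (∫⁻ y, ‖f j y‖ₑ ^ t ∂(cubeProb c (2 ^ k * l))) ^ (1 / t)) (Finset.mem_univ i), ← mul_assoc]
        exact mul_le_mul' hi (Finset.prod_le_prod' hj)
    _ = (∑ i, C i) * (k + 1) * bmoNorm b * (volume (cube c (2 ^ k * l)) ^ (α / n) *
        ∏ j, (∫⁻ y, ‖f j y‖ₑ ^ t ∂(cubeProb c (2 ^ k * l))) ^ (1 / t)) := by ring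
    _ ≤ _ := by
        gcongr
        exact le_multiFracMaximal α t f hside hx

theorem memLp_mulEntry {b : Rn n → 𝕜} (hb : MemBMO b) (κ : 𝕜) {f : Fin m → Rn n → 𝕜}
    (hf : ∀ j, Measurable (f j) ∧ (∃ M : ℝ, ∀ y, ‖f j y‖ ≤ M) ∧ HasCompactSupport (f j))
    (i j : Fin m) {p : ℝ} (hp : 1 ≤ p) :
    MemLp (mulEntry f i b κ j) (ENNReal.ofReal p) volume := by
  rw [mulEntry]
  rcases eq_or_ne j i with rfl | hj
  · obtain ⟨M, hM⟩ := (hf j).2.1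
    rw [Function.update_self]
    exact hb.memLp_sub_const_mul κ (hf j).1 hM (hf j).2.2 hp
  · obtain ⟨M, hM⟩ := (hf j).2.1
    rw [Function.update_of_ne hj]
    exact memLp_of_bounded_of_hasCompactSupport (hf j).1 hM (hf j).2.2 p

theorem hasCompactSupport_mulEntry {f : Fin m → Rn n → 𝕜} (hf : ∀ j, HasCompactSupport (f j))
    (b : Rn n → 𝕜) (κ : 𝕜) (i j : Fin m) : HasCompactSupport (mulEntry f i b κ j) := by
  rw [mulEntry]
  rcases eq_or_ne j i with rfl | hj
  · rw [Function.update_self]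
    exact (hf j).mul_left
  · rw [Function.update_of_ne hj]
    exact hf j

/-- The part of the operator near the diagonal. -/
theorem local_part_le {s : Fin m → ℝ} {T : LpMultilinear n m 𝕜 s} {α t δ q : ℝ}
    (hs : ∀ j, 1 ≤ s j) (ht : ∀ j, s j < t) (hδ : 0 < δ) (hδq : δ < q)
    (hq : 1 / q = ∑ j, 1 / s j - α / n) (hT : WeakBounded T q) :
    ∃ C : ℝ≥0∞, C ≠ ∞ ∧ ∀ b : Rn n → 𝕜, MemBMO b → ∀ f : Fin m → Rn n → 𝕜,
      (∀ j, Measurable (f j) ∧ (∃ M : ℝ, ∀ y, ‖f j y‖ ≤ M) ∧ HasCompactSupport (f j)) →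
      ∀ (i : Fin m) (c : Rn n) (l : ℝ), 0 < l → ∀ x ∈ cube c l,
      (∫⁻ y, ‖applyFun T (fun j => (cube c l).indicator
          (mulEntry f i b (⨍ z in cube c l, b z) j)) y‖ₑ ^ δ ∂(cubeProb c l)) ^ (1 / δ) ≤
        C * (bmoNorm b * multiFracMaximal α t f x) := by
  obtain ⟨B, hB0, hB⟩ := hT
  obtain ⟨C₁, hC₁, H₁⟩ := kolmogorov_cube n 𝕜 hδ hδq
  obtain ⟨C₂, hC₂, H₂⟩ := prod_mulEntry_le n 𝕜 α hs ht
  refine ⟨C₁ * (ENNReal.ofReal B * C₂),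
    ENNReal.mul_ne_top hC₁ (ENNReal.mul_ne_top ENNReal.ofReal_ne_top hC₂), ?_⟩
  intro b hb f hf i c l hl x hx
  set κ := ⨍ z in cube c l, b z
  set g := mulEntry f i b κ with hg
  have hgm : ∀ j, MemLp (g j) (ENNReal.ofReal (s j)) (volume : Measure (Rn n)) := fun j =>
    memLp_mulEntry hb κ hf i j (hs j)
  have hm0 : ∀ j, MemLp ((cube c l).indicator (g j)) (ENNReal.ofReal (s j))
      (volume : Measure (Rn n)) := fun j => (hgm j).indicator (measurableSet_cube c l)
  have hW := weakNorm_applyFun_le T hB hm0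
  have hWt : weakNorm q (applyFun T fun j => (cube c l).indicator (g j)) ≠ ∞ :=
    ne_top_of_le_ne_top (ENNReal.mul_ne_top ENNReal.ofReal_ne_top
      (ENNReal.prod_ne_top fun j _ => (hm0 j).2.ne)) hW
  have hV : 0 < l ^ n := by positivity
  have hnorm : ∀ j, eLpNorm ((cube c l).indicator (g j)) (ENNReal.ofReal (s j)) volume =
      ENNReal.ofReal ((l ^ n) ^ (1 / s j)) *
        (∫⁻ y, ‖g j y‖ₑ ^ s j ∂(cubeProb c l)) ^ (1 / s j) := by
    intro j
    have hsj : 0 < s j := by linarith [hs j]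
    rw [eLpNorm_indicator_eq_eLpNorm_restrict (measurableSet_cube c l),
      eLpNorm_eq_lintegral_rpow_enorm_toReal (by simpa using hsj) ENNReal.ofReal_ne_top,
      ENNReal.toReal_ofReal hsj.le, setLIntegral_cube_eq c hl,
      ENNReal.mul_rpow_of_nonneg _ _ (by positivity), volume_cube c hl,
      ENNReal.ofReal_rpow_of_pos hV]
  -- Kolmogorov contributes `-1/q` and the unnormalized norms contribute `∑ 1/s_j`; by `hq` the
  -- exponents add up to `α/n`.
  have hprod : ENNReal.ofReal ((l ^ n) ^ (-(1 / q))) * ∏ j, ENNReal.ofReal ((l ^ n) ^ (1 / s j)) =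
      volume (cube c l) ^ (α / n) := by
    rw [← ENNReal.ofReal_prod_of_nonneg fun _ _ => by positivity, ← Real.rpow_sum_of_pos hV,
      ← ENNReal.ofReal_mul (by positivity), ← Real.rpow_add hV, volume_cube c hl,
      ENNReal.ofReal_rpow_of_pos hV]
    congr 2
    linarith
  have h2 := H₂ b hb f (fun j => (hf j).1.aestronglyMeasurable) i c l hl 0 x (by simpa using hx)
  rw [pow_zero, one_mul, Nat.cast_zero, zero_add, mul_one] at h2
  calc _ ≤ C₁ * (volume (cube c l) ^ (-(1 / q)) *
        weakNorm q (applyFun T fun j => (cube c l).indicator (g j))) :=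
        H₁ _ (aestronglyMeasurable_applyFun T _) hWt c l hl
    _ ≤ C₁ * (volume (cube c l) ^ (-(1 / q)) * (ENNReal.ofReal B *
        ∏ j, eLpNorm ((cube c l).indicator (g j)) (ENNReal.ofReal (s j)) volume)) := by gcongr
    _ = C₁ * (ENNReal.ofReal B * (volume (cube c l) ^ (α / n) *
        ∏ j, (∫⁻ y, ‖g j y‖ₑ ^ s j ∂(cubeProb c l)) ^ (1 / s j))) := by
        simp_rw [hnorm]
        rw [Finset.prod_mul_distrib, ← hprod, volume_cube c hl, ENNReal.ofReal_rpow_of_pos hV]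
        ring
    _ ≤ C₁ * (ENNReal.ofReal B * (C₂ * bmoNorm b * multiFracMaximal α t f x)) := by gcongr
    _ = _ := by ring

/-- The product of an oscillation and a function, by Hölder and John–Nirenberg. -/
theorem oscillation_mul_le (n : ℕ) (𝕜 : Type*) [RCLike 𝕜] {δ ε a : ℝ} (hδ : 0 < δ) (hε : δ < ε)
    (ha : 1 ≤ a) :
    ∃ C : ℝ≥0∞, C ≠ ∞ ∧ ∀ b : Rn n → 𝕜, MemBMO b → ∀ h : Rn n → 𝕜,
      AEStronglyMeasurable h volume → ∀ (c : Rn n) (l : ℝ), 0 < l → ∀ x ∈ cube c l,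
      (∫⁻ y, ‖(b y - ⨍ z in cube c (a * l), b z) * h y‖ₑ ^ δ ∂(cubeProb c l)) ^ (1 / δ) ≤
        C * (bmoNorm b * powMaximal ε h x) := by
  have ha0 : 0 < a := by linarith
  set r := δ * ε / (ε - δ) with hr
  have hr0 : 0 < r := div_pos (mul_pos hδ (hδ.trans hε)) (sub_pos.2 hε)
  obtain ⟨C, hC, H⟩ := john_nirenberg_cube n 𝕜 hr0
  refine ⟨ENNReal.ofReal (a ^ n) ^ (1 / r) * C, ENNReal.mul_ne_top
    (ENNReal.rpow_ne_top_of_nonneg (by positivity) ENNReal.ofReal_ne_top) hC, ?_⟩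
  intro b hb h hh c l hl x hx
  have hac := cubeProb_absolutelyContinuous c l
  refine (lintegral_enorm_mul_rpow_le hδ hε ((hb.1.aestronglyMeasurable.mono_ac hac).sub
    aestronglyMeasurable_const) (hh.mono_ac hac)).trans ?_
  rw [← hr, mul_assoc, ← mul_assoc C, ← mul_assoc]
  gcongr
  · calc _ ≤ (ENNReal.ofReal (a ^ n) * ∫⁻ y, ‖b y - ⨍ z in cube c (a * l), b z‖ₑ ^ r
        ∂(cubeProb c (a * l))) ^ (1 / r) := by
          gcongr
          exact lintegral_cubeProb_le_of_subset hl ha0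
            (cube_subset_cube_of_le c (le_mul_of_one_le_left hl.le ha)) _
      _ ≤ _ := by
          rw [ENNReal.mul_rpow_of_nonneg _ _ (by positivity)]
          gcongr
          exact H b hb c _ (by positivity)
  · exact le_powMaximal (hδ.trans hε) h hl hx

end Estimates

end FracMultilinear

namespace FracMultilinear

/-! ### The sharp maximal function for small exponents -/

section Sharp

variable {n m : ℕ} {𝕜 : Type*} [RCLike 𝕜]

/-- The power `δ ≤ 1` is subadditive; the triangle inequality is used in both orders of `u` and `v`.
-/
theorem enorm_rpow_sub_rpow_le {δ : ℝ} (hδ : 0 < δ) (hδ1 : δ ≤ 1) (u v : 𝕜) :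
    ‖‖u‖ ^ δ - ‖v‖ ^ δ‖ₑ ≤ ‖u - v‖ₑ ^ δ := by
  rw [← enorm_norm (u - v), ← Real.enorm_rpow_of_nonneg (norm_nonneg _) hδ.le, ← ofReal_norm,
    ← ofReal_norm]
  refine ENNReal.ofReal_le_ofReal ?_
  rw [Real.norm_eq_abs, Real.norm_of_nonneg (by positivity)]
  have h : ∀ u v : 𝕜, ‖u‖ ^ δ ≤ ‖v‖ ^ δ + ‖u - v‖ ^ δ := by
    intro u v
    refine (Real.rpow_le_rpow (norm_nonneg _) (norm_le_norm_add_norm_sub' u v) hδ.le).trans ?_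
    exact_mod_cast NNReal.rpow_add_le_add_rpow ‖v‖₊ ‖u - v‖₊ hδ.le hδ1
  have h1 := h u v
  have h2 := h v u
  rw [norm_sub_rev] at h2
  exact abs_le.2 ⟨by linarith, by linarith⟩

theorem sum_rpow_le_sum_rpow {ι : Type*} (S : Finset ι) (a : ι → ℝ≥0∞) {δ : ℝ} (hδ : 0 < δ)
    (hδ1 : δ ≤ 1) : (∑ i ∈ S, a i) ^ δ ≤ ∑ i ∈ S, a i ^ δ :=
  Finset.le_sum_of_subadditive (fun x : ℝ≥0∞ => x ^ δ) (ENNReal.zero_rpow_of_pos hδ).le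
    (fun x y => ENNReal.rpow_add_le_add_rpow x y hδ.le hδ1) S a

/-- Bounding `M_δ^♯` by the distance of the function from suitable constants. -/
theorem powSharpMaximal_le {δ : ℝ} (hδ : 0 < δ) (hδ1 : δ ≤ 1) {G : Rn n → 𝕜}
    (hG : AEStronglyMeasurable G volume) {x : Rn n} {X : ℝ≥0∞}
    (h : ∀ (c : Rn n) (l : ℝ), 0 < l → x ∈ cube c l →
      ∃ κ : 𝕜, ∫⁻ y, ‖G y - κ‖ₑ ^ δ ∂(cubeProb c l) ≤ X) :
    powSharpMaximal δ G x ≤ (2 * X) ^ (1 / δ) := by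
  rw [powSharpMaximal]
  gcongr
  refine iSup_le fun c => iSup_le fun l => iSup_le fun hl => iSup_le fun hx => ?_
  obtain ⟨κ, hκ⟩ := h c l hl hx
  have hm : AEStronglyMeasurable (fun y => ‖G y‖ ^ δ) (volume.restrict (cube c l)) :=
    (hG.restrict.norm.aemeasurable.pow_const δ).aestronglyMeasurable
  rw [laverage_cube, lintegral_cubeProb]
  calc _ ≤ (volume (cube c l))⁻¹ * (2 * ∫⁻ y in cube c l, ‖‖G y‖ ^ δ - ‖κ‖ ^ δ‖ₑ) := by
        gcongr
        exact lintegral_enorm_sub_average_le hm (volume_cube_ne_top c hl) _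
    _ = 2 * ∫⁻ y, ‖‖G y‖ ^ δ - ‖κ‖ ^ δ‖ₑ ∂(cubeProb c l) := by
        rw [lintegral_cubeProb]; ring
    _ ≤ 2 * ∫⁻ y, ‖G y - κ‖ₑ ^ δ ∂(cubeProb c l) := by
        gcongr with y
        exact enorm_rpow_sub_rpow_le hδ hδ1 _ _
    _ ≤ _ := by gcongr

end Sharp

/-! ### The far part and the centred form of the commutator -/

section Commutator

variable {n m : ℕ} {𝕜 : Type*} [RCLike 𝕜]

/-- The part of the operator away from the diagonal. -/
theorem far_part_le {α p₀ p₀' t : ℝ} {Ck : ℕ → ℝ} {K : Rn n → (Fin m → Rn n) → 𝕜}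
    (hm : 0 < m) (hn : 0 < n) (hp : 1 < p₀) (hpp : 1 / p₀ + 1 / p₀' = 1) (hp' : 1 ≤ p₀')
    (he : α - (m : ℝ) * n / p₀' ≤ 0) (hCk : ∀ k, 1 ≤ k → 0 < Ck k)
    (hsum : Summable fun k : ℕ => (k : ℝ) * Ck k) (ht : p₀' < t)
    (hsm : GeneralizedSmooth α p₀ p₀' Ck K) :
    ∃ C : ℝ≥0∞, C ≠ ∞ ∧ ∀ b : Rn n → 𝕜, MemBMO b → ∀ f : Fin m → Rn n → 𝕜,
      (∀ j, Measurable (f j) ∧ (∃ M : ℝ, ∀ y, ‖f j y‖ ≤ M) ∧ HasCompactSupport (f j)) →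
      ∀ (i : Fin m) (c : Rn n) (l : ℝ), 0 < l → ∀ x ∈ cube c l, ∀ z ∈ cube c l,
      ∀ w ∈ cube (diagShift c l) l, AEStronglyMeasurable (K z) volume →
      AEStronglyMeasurable (K w) volume →
      ∫⁻ y in (cubeProd m c (13 * (m * n) * l))ᶜ, ‖K z y - K w y‖ₑ *
        ∏ j, ‖mulEntry f i b (⨍ z in cube c (13 * (m * n) * l), b z) j (y j)‖ₑ ≤
        C * (bmoNorm b * multiFracMaximal α t f x) := by
  obtain ⟨A, hA, hsm⟩ := hsm
  obtain ⟨C₁, hC₁, H₁⟩ := prod_mulEntry_le (m := m) n 𝕜 α (s := fun _ => p₀') (t := t)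
    (fun _ => hp') (fun _ => ht)
  -- The weight `k + 2` is the oscillation cost of `k + 1` doublings; it is at most `2(k + 1)`,
  -- which reduces the claim to `∑ k C_k < ∞`.
  have hS : ∑' k : ℕ, ENNReal.ofReal (Ck (k + 1)) * ((k : ℝ≥0∞) + 2) ≠ ∞ := by
    have h1 : Summable fun k : ℕ => 2 * (((k + 1 : ℕ) : ℝ) * Ck (k + 1)) :=
      ((summable_nat_add_iff 1).2 hsum).mul_left 2
    refine ne_top_of_le_ne_top h1.tsum_ofReal_ne_top (ENNReal.tsum_le_tsum fun k => ?_)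
    have h2 := (hCk (k + 1) (by omega)).le
    have h3 : ((k : ℝ≥0∞) + 2) = ENNReal.ofReal ((k : ℝ) + 2) := by
      rw [ENNReal.ofReal_add (by positivity) zero_le_two, ENNReal.ofReal_natCast,
        ENNReal.ofReal_ofNat]
    rw [h3, ← ENNReal.ofReal_mul h2]
    refine ENNReal.ofReal_le_ofReal ?_
    push_cast
    nlinarith [mul_nonneg (Nat.cast_nonneg (α := ℝ) k) h2]
  refine ⟨ENNReal.ofReal (A * (13 * (m * n)) ^ ((m : ℝ) * n / p₀' - α)) *
    ((∑' k : ℕ, ENNReal.ofReal (Ck (k + 1)) * ((k : ℝ≥0∞) + 2)) * C₁),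
    ENNReal.mul_ne_top ENNReal.ofReal_ne_top (ENNReal.mul_ne_top hS hC₁), ?_⟩
  intro b hb f hf i c l hl x hx z hz w hw hKz hKw
  have hmn : (1 : ℝ) ≤ m * n := by exact_mod_cast Nat.mul_pos hm hn
  have hside : 0 < 13 * ((m : ℝ) * n) * l := by positivity
  refine (lintegral_kernel_sub_le hm hn hp hpp he hCk hA hsm
    (fun j => memLp_mulEntry hb _ hf i j hp') hl hz hw hKz hKw).trans ?_
  rw [mul_assoc (ENNReal.ofReal _)]
  gcongr
  rw [mul_assoc (∑' k : ℕ, ENNReal.ofReal (Ck (k + 1)) * ((k : ℝ≥0∞) + 2)),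
    ← ENNReal.tsum_mul_right]
  refine ENNReal.tsum_le_tsum fun k => ?_
  have hxk : x ∈ cube c (2 ^ (k + 1) * (13 * (m * n) * l)) := by
    refine cube_subset_cube_of_le c ?_ hx
    have h1 : (1 : ℝ) ≤ 2 ^ (k + 1) := one_le_pow₀ (by norm_num)
    calc l = 1 * (1 * l) := by ring
      _ ≤ 2 ^ (k + 1) * (13 * (m * n) * l) := by
        gcongr
        linarith
  refine (mul_le_mul' le_rfl
    (H₁ b hb f (fun j => (hf j).1.aestronglyMeasurable) i c _ hside (k + 1) x hxk)).trans_eq ?_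
  have h2 : (((k + 1 : ℕ) : ℝ≥0∞) + 1) = k + 2 := by
    push_cast
    rw [add_assoc, one_add_one_eq_two]
  rw [h2]
  ring

/-- Subtracting `κ i` from `b i` changes both terms of the `i`-th commutator by `κ i * T(f)`. The
identity is only almost everywhere, because the operator takes values in classes of functions. -/
theorem multiCommutator_ae_eq {s : Fin m → ℝ} (T : LpMultilinear n m 𝕜 s)
    (hs : ∀ j, 1 ≤ s j) {b : Fin m → Rn n → 𝕜} (hb : ∀ j, MemBMO (b j)) {f : Fin m → Rn n → 𝕜}
    (hf : ∀ j, Measurable (f j) ∧ (∃ M : ℝ, ∀ y, ‖f j y‖ ≤ M) ∧ HasCompactSupport (f j))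
    (κ : Fin m → 𝕜) :
    ∀ᵐ z ∂(volume : Measure (Rn n)), multiCommutator T b f z =
      ∑ i, ((b i z - κ i) * applyFun T f z - applyFun T (mulEntry f i (b i) (κ i)) z) := by
  have hfm : ∀ j, MemLp (f j) (ENNReal.ofReal (s j)) (volume : Measure (Rn n)) := fun j => by
    obtain ⟨M, hM⟩ := (hf j).2.1
    exact memLp_of_bounded_of_hasCompactSupport (hf j).1 hM (hf j).2.2 _
  have key : ∀ i, ∀ᵐ z ∂(volume : Measure (Rn n)),
      applyFun T (mulEntry f i (b i) (κ i)) z =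
        applyFun T (Function.update f i fun y => b i y * f i y) z - κ i * applyFun T f z := by
    intro i
    have hu : MemLp (fun y => b i y * f i y) (ENNReal.ofReal (s i))
        (volume : Measure (Rn n)) := by
      obtain ⟨M, hM⟩ := (hf i).2.1
      simpa using (hb i).memLp_sub_const_mul 0 (hf i).1 hM (hf i).2.2 (hs i)
    have e : mulEntry f i (b i) (κ i) =
        Function.update f i ((fun y => b i y * f i y) - κ i • f i) := by
      rw [mulEntry]
      congr 1
      ext y
      simp [sub_mul]
    have h1 := applyFun_update_sub T hfm hu ((hfm i).const_smul (κ i))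
    have h2 := applyFun_update_smul T hfm (hfm i) (κ i)
    rw [← e] at h1
    rw [Function.update_eq_self] at h2
    filter_upwards [h1, h2] with z hz1 hz2
    rw [hz1, Pi.sub_apply, hz2, Pi.smul_apply, smul_eq_mul]
  filter_upwards [ae_all_iff.2 key] with z hz
  rw [multiCommutator]
  refine Finset.sum_congr rfl fun i _ => ?_
  rw [hz i]
  ring

theorem aestronglyMeasurable_multiCommutator {s : Fin m → ℝ} (T : LpMultilinear n m 𝕜 s)
    {b : Fin m → Rn n → 𝕜} (hb : ∀ j, MemBMO (b j)) (f : Fin m → Rn n → 𝕜) :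
    AEStronglyMeasurable (multiCommutator T b f) volume := by
  refine Finset.aestronglyMeasurable_fun_sum _ fun i _ => ?_
  exact ((hb i).1.aestronglyMeasurable.mul (aestronglyMeasurable_applyFun T f)).sub
    (aestronglyMeasurable_applyFun T _)

end Commutator

end FracMultilinear

/-! ### The pointwise estimate -/

open FracMultilinear
theorem theorem2p2 {𝕜 : Type*} [RCLike 𝕜] {n m : ℕ} (hm : 2 ≤ m)
    {α p₀ p₀' : ℝ} (hp : 1 < p₀) (hpp : 1 / p₀ + 1 / p₀' = 1)
    (hα : 0 < α * p₀') (hα' : α * p₀' < (m : ℝ) * n)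
    {s : Fin m → ℝ} (hs : ∀ j, 1 ≤ s j ∧ s j ≤ p₀')
    {σ : ℝ} (hσ : 1 / σ = ∑ j, 1 / s j)
    {Ck : ℕ → ℝ} (hCk : ∀ k, 1 ≤ k → 0 < Ck k) (hsum : Summable fun k : ℕ => (k : ℝ) * Ck k)
    (K : Rn n → (Fin m → Rn n) → 𝕜) (T : LpMultilinear n m 𝕜 s)
    (hT : IsGeneralizedFracOperator α p₀ p₀' σ Ck K T)
    {δ t ε : ℝ} (hδ : 0 < δ) (hδ' : δ < min 1 (σ * n / (n - σ * α)))
    (ht : p₀' < t) (hε : δ < ε) :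
    ∃ C : ℝ, 0 < C ∧
      ∀ b : Fin m → Rn n → 𝕜, (∀ j, MemBMO (b j)) →
      ∀ f : Fin m → Rn n → 𝕜,
        (∀ j, Measurable (f j) ∧ (∃ M : ℝ, ∀ y, ‖f j y‖ ≤ M) ∧ HasCompactSupport (f j)) →
      ∀ x : Rn n,
        powSharpMaximal δ (multiCommutator T b f) x ≤
          ENNReal.ofReal C * bmoNormVec b *
            (multiFracMaximal α t f x + powMaximal ε (applyFun T f) x) := by
  obtain ⟨hδ1, hδq⟩ := lt_min_iff.1 hδ'
  have hm0 : 0 < m := by omega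
  have hn : 0 < n := by
    rcases Nat.eq_zero_or_pos n with rfl | h
    · rw [Nat.cast_zero, mul_zero] at hα'
      linarith
    · exact h
  have hn' : (0 : ℝ) < n := by exact_mod_cast hn
  have hmn : (1 : ℝ) ≤ m * n := by exact_mod_cast Nat.mul_pos hm0 hn
  have hs1 : ∀ j, 1 ≤ s j := fun j => (hs j).1
  have hp' : 1 ≤ p₀' := (hs ⟨0, hm0⟩).1.trans (hs ⟨0, hm0⟩).2
  have hp'0 : 0 < p₀' := by linarith
  have hα0 : 0 < α := pos_of_mul_pos_left hα hp'0.le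
  have he : α - (m : ℝ) * n / p₀' ≤ 0 := by
    rw [sub_nonpos, le_div_iff₀ hp'0]
    exact hα'.le
  have hαmn : α ≤ (m : ℝ) * n := by nlinarith
  set q := σ * n / (n - σ * α) with hq
  have hq0 : 0 < q := hδ.trans hδq
  have hσ0 : 0 < σ := by
    rw [← one_div_pos, hσ]
    exact Finset.sum_pos (fun j _ => one_div_pos.2 (by linarith [hs1 j])) ⟨⟨0, hm0⟩, Finset.mem_univ _⟩
  have hq' : 1 / q = ∑ j, 1 / s j - α / n := by
    rw [hq, ← hσ, one_div_div]
    field_simp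
  set L : ℝ := 13 * (m * n) with hL
  have hL1 : 1 < L := by linarith
  obtain ⟨C₁, hC₁, H₁⟩ := oscillation_mul_le n 𝕜 hδ hε hL1.le
  obtain ⟨C₂, hC₂, H₂⟩ := local_part_le (T := T) (t := t) hs1
    (fun j => (hs j).2.trans_lt ht) hδ hδq hq' hT.weakBounded
  obtain ⟨C₃, hC₃, H₃⟩ := far_part_le hm0 hn hp hpp hp' he hCk hsum ht hT.smooth
  -- The estimates are added as `δ`-th powers, three for each of the `m` entries. The factor `L^n`
  -- is the volume ratio paid in the near part for passing from the average over `Q` to that over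
  -- `LQ`.
  set D : ℝ≥0∞ := m * (C₁ ^ δ + ENNReal.ofReal (L ^ n) * C₂ ^ δ + C₃ ^ δ) with hD
  have hDt : D ≠ ∞ := by
    refine ENNReal.mul_ne_top (ENNReal.natCast_ne_top m) ?_
    refine ENNReal.add_ne_top.2 ⟨ENNReal.add_ne_top.2 ⟨?_, ENNReal.mul_ne_top
      ENNReal.ofReal_ne_top ?_⟩, ?_⟩ <;>
    exact ENNReal.rpow_ne_top_of_nonneg hδ.le (by assumption)
  have hDt' : (2 * D) ^ (1 / δ) ≠ ∞ :=
    ENNReal.rpow_ne_top_of_nonneg (by positivity) (ENNReal.mul_ne_top (by norm_num) hDt)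
  refine ⟨((2 * D) ^ (1 / δ)).toReal + 1, by positivity, ?_⟩
  intro b hb f hf x
  set Y := bmoNormVec b * (multiFracMaximal α t f x + powMaximal ε (applyFun T f) x) with hY
  have hbmo : ∀ i, bmoNorm (b i) ≤ bmoNormVec b := fun i => le_iSup (fun j => bmoNorm (b j)) i
  suffices h : ∀ (c : Rn n) (l : ℝ), 0 < l → x ∈ cube c l →
      ∃ κ : 𝕜, ∫⁻ y, ‖multiCommutator T b f y - κ‖ₑ ^ δ ∂(cubeProb c l) ≤ D * Y ^ δ by
    refine (powSharpMaximal_le hδ hδ1.le (aestronglyMeasurable_multiCommutator T hb f) h).trans ?_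
    rw [← mul_assoc, ENNReal.mul_rpow_of_nonneg _ _ (by positivity), one_div,
      ENNReal.rpow_rpow_inv hδ.ne', hY, mul_assoc, ← one_div]
    gcongr
    rw [ENNReal.ofReal_add ENNReal.toReal_nonneg zero_le_one, ENNReal.ofReal_toReal hDt']
    exact le_self_add
  intro c l hl hx
  have hLl : l < L * l := lt_mul_of_one_lt_left hl hL1
  have hside : 0 < L * l := hl.trans hLl
  have := isProbabilityMeasure_cubeProb c hl
  have hac := cubeProb_absolutelyContinuous c l
  set κ : Fin m → 𝕜 := fun i => ⨍ z in cube c (L * l), b i z with hκ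
  have hg : ∀ i j, MemLp (mulEntry f i (b i) (κ i) j) (ENNReal.ofReal (s j)) volume := fun i j =>
    memLp_mulEntry (hb i) _ hf i j (hs1 j)
  have hgc : ∀ i j, HasCompactSupport (mulEntry f i (b i) (κ i) j) := fun i j =>
    hasCompactSupport_mulEntry (fun j => (hf j).2.2) _ _ i j
  have hgi : ∀ i j, Integrable (mulEntry f i (b i) (κ i) j) volume := fun i j =>
    integrable_of_memLp_of_hasCompactSupport (hs1 j) (hg i j) (hgc i j)
  have hKm := hT.kernel.ae_aestronglyMeasurable hn hm0
  -- The comparison point needs a measurable kernel slice; almost every point of the shifted cube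
  -- has one, and that cube has positive measure.
  obtain ⟨w, hw, hKw⟩ := Measure.exists_mem_of_measure_ne_zero_of_ae
    (volume_cube_ne_zero (diagShift c l) hl) (ae_restrict_of_ae hKm)
  set I : Fin m → Rn n → 𝕜 := fun i z =>
    ∫ y in (cubeProd m c (L * l))ᶜ, K z y * ∏ j, mulEntry f i (b i) (κ i) j (y j) with hI
  set g0 : Fin m → Rn n → 𝕜 := fun i =>
    applyFun T fun j => (cube c (L * l)).indicator (mulEntry f i (b i) (κ i) j) with hg0
  have hfar : ∀ i, ∀ z ∈ cube c l, AEStronglyMeasurable (K z) volume →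
      ‖I i z - I i w‖ₑ ≤ C₃ * Y := by
    intro i z hz hKz
    have i1 := integrableOn_kernel_mul_prod hαmn hT.kernel hKz (d := l / 2) (l := L * l)
      (by linarith) hz (hgi i)
    have i2 := integrableOn_kernel_mul_prod hαmn hT.kernel hKw (d := 5 / 2 * l) (l := L * l)
      (by nlinarith) (fun k => (coord_bounds_of_mem_diagShift hz hw k).2.2) (hgi i)
    rw [hI]
    simp only
    rw [← integral_sub i1 i2]
    refine (enorm_integral_le_lintegral_enorm _).trans ?_
    calc _ = ∫⁻ y in (cubeProd m c (L * l))ᶜ, ‖K z y - K w y‖ₑ *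
          ∏ j, ‖mulEntry f i (b i) (κ i) j (y j)‖ₑ := by
          refine lintegral_congr fun y => ?_
          rw [← sub_mul, enorm_mul]
          congr 1
          rw [← ofReal_norm, norm_prod, ENNReal.ofReal_prod_of_nonneg fun _ _ => norm_nonneg _]
          simp
      _ ≤ C₃ * (bmoNorm (b i) * multiFracMaximal α t f x) :=
          H₃ (b i) (hb i) f hf i c l hl x hx z hz w hw hKz hKw
      _ ≤ C₃ * Y := by
          rw [hY]
          gcongr
          · exact hbmo i
          · exact le_self_add
  -- Almost everywhere on `Q`, `T(g_i) = g0 i + I i`. Adding `∑ I i w` therefore leaves, for each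
  -- `i`, a product term, a near term and the kernel difference `I i z - I i w`.
  have hdec : ∀ᵐ z ∂(cubeProb c l), ‖multiCommutator T b f z - (-∑ i, I i w)‖ₑ ^ δ ≤
      ∑ i, (‖(b i z - κ i) * applyFun T f z‖ₑ ^ δ + ‖g0 i z‖ₑ ^ δ + (C₃ * Y) ^ δ) := by
    have hQ : ∀ᵐ z ∂(cubeProb c l), z ∈ cube c l :=
      Measure.ae_smul_measure (ae_restrict_mem (measurableSet_cube c l)) _
    have hrep : ∀ i, ∀ᵐ z ∂(volume : Measure (Rn n)), z ∈ cube c l →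
        applyFun T (mulEntry f i (b i) (κ i)) z - g0 i z = I i z := fun i =>
      applyFun_sub_applyFun_indicator hn hm0 hs1 hαmn hq0 hT.kernel hT.hasKernel hT.weakBounded
        (hg i) (hgc i) c hLl
    filter_upwards [hQ, hac.ae_le (multiCommutator_ae_eq T hs1 hb hf κ),
      hac.ae_le (ae_all_iff.2 hrep), hac.ae_le hKm] with z hzQ hz1 hz2 hz3
    have e : multiCommutator T b f z - (-∑ i, I i w) =
        ∑ i, ((b i z - κ i) * applyFun T f z - g0 i z - (I i z - I i w)) := by
      rw [hz1, sub_neg_eq_add, ← Finset.sum_add_distrib]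
      refine Finset.sum_congr rfl fun i _ => ?_
      rw [← hz2 i hzQ]
      ring
    rw [e]
    refine (ENNReal.rpow_le_rpow (enorm_sum_le _ _) hδ.le).trans
      ((sum_rpow_le_sum_rpow _ _ hδ hδ1.le).trans (Finset.sum_le_sum fun i _ => ?_))
    calc ‖(b i z - κ i) * applyFun T f z - g0 i z - (I i z - I i w)‖ₑ ^ δ
        ≤ (‖(b i z - κ i) * applyFun T f z‖ₑ + ‖g0 i z‖ₑ + C₃ * Y) ^ δ := by
          gcongr
          refine enorm_sub_le.trans (add_le_add enorm_sub_le (hfar i z hzQ hz3))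
      _ ≤ (‖(b i z - κ i) * applyFun T f z‖ₑ + ‖g0 i z‖ₑ) ^ δ + (C₃ * Y) ^ δ :=
          ENNReal.rpow_add_le_add_rpow _ _ hδ.le hδ1.le
      _ ≤ _ := by
          gcongr
          exact ENNReal.rpow_add_le_add_rpow _ _ hδ.le hδ1.le
  refine ⟨-∑ i, I i w, (lintegral_mono_ae hdec).trans ?_⟩
  have m1 : ∀ i, AEMeasurable (fun z => ‖(b i z - κ i) * applyFun T f z‖ₑ ^ δ) (cubeProb c l) :=
    fun i => (((((hb i).1.aestronglyMeasurable.sub aestronglyMeasurable_const).mul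
      (aestronglyMeasurable_applyFun T f)).mono_ac hac).enorm).pow_const δ
  have m2 : ∀ i, AEMeasurable (fun z => ‖g0 i z‖ₑ ^ δ) (cubeProb c l) := fun i =>
    ((aestronglyMeasurable_applyFun T _).mono_ac hac).enorm.pow_const δ
  have m12 : ∀ i, AEMeasurable (fun z => ‖(b i z - κ i) * applyFun T f z‖ₑ ^ δ + ‖g0 i z‖ₑ ^ δ)
      (cubeProb c l) := fun i => (m1 i).add (m2 i)
  have m3 : ∀ i, AEMeasurable (fun z => ‖(b i z - κ i) * applyFun T f z‖ₑ ^ δ + ‖g0 i z‖ₑ ^ δ +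
      (C₃ * Y) ^ δ) (cubeProb c l) := fun i => (m12 i).add aemeasurable_const
  rw [lintegral_finsetSum' _ fun i _ => m3 i]
  have hterm : ∀ i, ∫⁻ z, (‖(b i z - κ i) * applyFun T f z‖ₑ ^ δ + ‖g0 i z‖ₑ ^ δ + (C₃ * Y) ^ δ)
      ∂(cubeProb c l) ≤ (C₁ ^ δ + ENNReal.ofReal (L ^ n) * C₂ ^ δ + C₃ ^ δ) * Y ^ δ := by
    intro i
    rw [lintegral_add_left' (m12 i), lintegral_add_left' (m1 i), lintegral_const,
      measure_univ, mul_one, add_mul, add_mul, ENNReal.mul_rpow_of_nonneg C₃ _ hδ.le]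
    gcongr
    · rw [← ENNReal.mul_rpow_of_nonneg _ _ hδ.le, ← ENNReal.rpow_inv_le_iff hδ, ← one_div]
      refine (H₁ (b i) (hb i) _ (aestronglyMeasurable_applyFun T f) c l hl x hx).trans ?_
      rw [hY]
      gcongr
      · exact hbmo i
      · exact le_add_self
    · refine (lintegral_cubeProb_le_of_subset hl (by linarith)
        (cube_subset_cube_of_le c hLl.le) _).trans ?_
      rw [mul_assoc (ENNReal.ofReal (L ^ n))]
      gcongr
      rw [← ENNReal.mul_rpow_of_nonneg _ _ hδ.le, ← ENNReal.rpow_inv_le_iff hδ, ← one_div]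
      refine (H₂ (b i) (hb i) f hf i c (L * l) hside x
        (cube_subset_cube_of_le c hLl.le hx)).trans ?_
      rw [hY]
      gcongr
      · exact hbmo i
      · exact le_self_add
  refine (Finset.sum_le_sum fun i _ => hterm i).trans_eq ?_
  rw [Finset.sum_const, Finset.card_univ, Fintype.card_fin, nsmul_eq_mul, hD, mul_assoc]
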